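/- **Setting.** Let $\tilde{\mathcal D}$ be a probability distribution of data samples $\xi$ and, for $\theta\in\mathbb R^d$, let $\ell(\theta;\xi)$ be a loss that is differentiable in $\theta$, with $\|\nabla\ell(\theta;\xi)\|_2$ bounded by a constant uniformly in $\theta$ and $\xi$, and integrable in $\xi$. Assume that $\mathcal L(\theta)=\mathbb E_{\xi\sim\tilde{\mathcal D}}[\ell(\theta;\xi)]$ is $\mathcal C^\infty$. Let $\Gamma\subset\mathbb R^d$ be a compact $\mathcal C^\infty$ submanifold (without boundary) of dimension $d-m$ such that $\operatorname{rank}\nabla^2\mathcal L(\phi)=m$ for all $\phi\in\Gamma$ and $\Gamma=\arg\min_{\theta\in U}\mathcal L(\theta)$ for some open neighbourhood $U$ of $\Gamma$. Fix a point $\theta_{\rm null}\notin\Gamma$. The gradient flow projection $\Phi(\theta)$ is $\lim_{t\to\infty}x(t)$, where $x'(t)=-\nabla\mathcal L(x(t))$ and $x(0)=\theta$, if this limit exists and lies in $\Gamma$; otherwise $\Phi(\theta)=\theta_{\rm null}$. Local SGD with $K\ge1$ workers, local batch size $B_{\rm loc}\ge 1$, learning rate $\eta$ and $H$ local steps per round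 starts at a deterministic point $\bar\theta^{(0)}$ with $\Phi(\bar\theta^{(0)})\in\Gamma$. In round $s$, every worker $k\in[K]$ starts at $\theta^{(s)}_{k,0}=\bar\theta^{(s)}$ and performs, for $0\le t<H$, the step $$\theta^{(s)}_{k,t+1}=\theta^{(s)}_{k,t}-\frac{\eta}{B_{\rm loc}}\sum_{i=1}^{B_{\rm loc}}\nabla\ell\big(\theta^{(s)}_{k,t};\xi^{(s)}_{k,t,i}\big),$$ where all the samples $\xi^{(s)}_{k,t,i}$ are i.i.d. with law $\tilde{\mathcal D}$; then $\bar\theta^{(s+1)}=\frac1K\sum_{k=1}^K\theta^{(s)}_{k,H}$. Let $T>0$ and $\alpha>0$ be constants, and let $H=\alpha/\eta$ (for those $\eta$ for which this is an integer). **Theorem (closeness of the iterates and $\Gamma$).** There are constants $C_1,C_2>0$, independent of $\eta$ and $\delta$, such that for every $p\in\mathbb N$ there is $\eta_0\in(0,1)$ such that the following holds for all $\eta\in(0,\eta_0]$ with $H=\alpha/\eta$ an integer and all $\delta$ with $\eta^p\le\delta<1$. With probability at least $1-\delta$, simultaneously for all integers $s$ with $C_1\log\frac1\eta\le s\le\lfloor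 T/(H\eta^2)\rfloor$, $$\Phi(\bar\theta^{(s)})\in\Gamma,\qquad \big\|\bar\theta^{(s)}-\Phi(\bar\theta^{(s)})\big\|_2\le C_2\sqrt{\eta\log\tfrac{1}{\eta\delta}},$$ and, for all integers $s$ with $C_1\log\frac1\eta\le s<\lfloor T/(H\eta^2)\rfloor$, all $k\in[K]$ and all $0\le t\le H$, $$\big\|\theta^{(s)}_{k,t}-\Phi(\bar\theta^{(s)})\big\|_2\le C_2\sqrt{\eta\log\tfrac{1}{\eta\delta}}.$$ -/

import Mathlib

open scoped ContDiff Topology Gradient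

noncomputable section

namespace LocalSGD

/-- The parameter space `ℝ^d` with its Euclidean norm. -/
abbrev Param (d : ℕ) : Type := EuclideanSpace ℝ (Fin d)

/-- The expected loss `𝓛(θ) = 𝔼_{ξ ∼ 𝒟} ℓ(θ; ξ)`. -/
def expectedLoss {d : ℕ} {X : Type*} [MeasurableSpace X] (ℓ : Param d → X → ℝ)
    (D : MeasureTheory.Measure X) (θ : Param d) : ℝ :=
  ∫ x, ℓ θ x ∂D

/-- `M` is an embedded `C^∞` submanifold (without boundary) of `ℝ^d` of codimension `m`: around
every point of `M` there is a smooth chart of `ℝ^d` that carries `M` to a linear subspace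
of codimension `m`. -/
def IsSmoothSubmanifold {d : ℕ} (m : ℕ) (M : Set (Param d)) : Prop :=
  ∀ p ∈ M, ∃ (e : OpenPartialHomeomorph (Param d) (Param d)) (W : Submodule ℝ (Param d)),
    Module.finrank ℝ W + m = d ∧ p ∈ e.source ∧
    ContDiffOn ℝ ∞ e e.source ∧ ContDiffOn ℝ ∞ e.symm e.target ∧
    e '' (e.source ∩ M) = e.target ∩ (W : Set (Param d))

/-- The rank of the Hessian `∇²L(θ)`, the derivative of the gradient field. -/
def hessianRank {d : ℕ} (L : Param d → ℝ) (θ : Param d) : ℕ :=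
  Module.finrank ℝ
    (LinearMap.range (fderiv ℝ (fun y => ∇ L y) θ : Param d →ₗ[ℝ] Param d))

/-- The gradient flow `x'(t) = -∇L(x(t))`, `t ≥ 0`, started at `θ` converges to `φ`. -/
def FlowConvergesTo {d : ℕ} (L : Param d → ℝ) (θ φ : Param d) : Prop :=
  ∃ x : ℝ → Param d, x 0 = θ ∧
    (∀ t : ℝ, 0 ≤ t → HasDerivWithinAt x (-(∇ L (x t))) (Set.Ici 0) t) ∧
    Filter.Tendsto x Filter.atTop (𝓝 φ)

open Classical in
/-- The gradient flow projection `Φ`: the limit of the gradient flow started at `θ` if this limit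
exists and lies in `Γ`, and the fixed point `θnull` (chosen outside of `Γ`) otherwise. -/
def flowProj {d : ℕ} (L : Param d → ℝ) (Γ : Set (Param d)) (θnull θ : Param d) : Param d :=
  if h : ∃ φ ∈ Γ, FlowConvergesTo L θ φ then h.choose else θnull

/-- The average gradient over a local batch of `B` samples. -/
def batchGrad {d : ℕ} {X : Type*} (ℓ : Param d → X → ℝ) {B : ℕ} (θ : Param d)
    (x : Fin B → X) : Param d :=
  (B : ℝ)⁻¹ • ∑ i, ∇ (fun y => ℓ y (x i)) θ

/-- `t` local SGD steps of a single worker started at `θ`; `x t` is the batch used at step `t`. -/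
def localIter {d : ℕ} {X : Type*} (ℓ : Param d → X → ℝ) {B : ℕ} (η : ℝ) (θ : Param d)
    (x : ℕ → Fin B → X) : ℕ → Param d
  | 0 => θ
  | t + 1 => localIter ℓ η θ x t - η • batchGrad ℓ (localIter ℓ η θ x t) (x t)

/-- The global iterate of Local SGD at the beginning of round `s`, with `K` workers and `H` local
steps per round; `x s k t` is the batch of worker `k` at local step `t` of round `s`. -/
def globalIter {d : ℕ} {X : Type*} (ℓ : Param d → X → ℝ) {K B : ℕ} (η : ℝ) (H : ℕ)
    (θ₀ : Param d) (x : ℕ → Fin K → ℕ → Fin B → X) : ℕ → Param d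
  | 0 => θ₀
  | s + 1 =>
      (K : ℝ)⁻¹ • ∑ k, localIter ℓ η (globalIter ℓ η H θ₀ x s) (x s k) H

end LocalSGD

end

noncomputable section

namespace LocalSGD

open Metric Set Filter

/-! ### Geometry of the loss near the minimizing manifold. -/

section GradientFlow

variable {d : ℕ}

/-! The potential is `Ψ(θ) = √(L θ - Lmin)`. Since the Hessian has rank `m` on a manifold of
codimension `m`, it degenerates only in tangent directions, so near the compact set `Γ` the gradient
dominates the distance to `Γ` (`exists_mul_infDist_le_norm_gradient`). This yields a
Polyak–Łojasiewicz inequality and quadratic growth in a tube around `Γ`. There `Ψ` decays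
exponentially along the gradient flow, the remaining length of a trajectory is `O(Ψ)`, so its limit
is within `O(Ψ)`, and `Ψ` is Lipschitz.

One round of local SGD lasts the fixed flow time `H η = α`. By Grönwall, each worker stays within
`O(η)` plus `η` times its accumulated noise of the flow started at the same point. The noise is a
sum of at most `H` bounded martingale differences; Hoeffding's lemma, Chernoff's bound and a union
bound over rounds, workers, steps and coordinates bound it by `O(√(H log(1/(ηδ))))` with probability
at least `1 - δ`. The error of a round is therefore `O(σ)` with `σ = √(η log(1/(ηδ)))`.

Errors do not pile up: a round acts on `Ψ` as `Ψ ↦ q Ψ + O(σ)` with `q = exp(-cα/2) < 1` independent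
of `η`, so after `O(log(1/η))` rounds `Ψ = O(σ)`, which controls the distance to the projection and,
by tracking once more, all local iterates. To enter the tube at all, the iterates follow the
convergent flow from the starting point for a number `s₀` of rounds not depending on `η`; the
tracking error, although exponential in `s₀`, is still `O(σ)`. -/

theorem contDiff_gradient {L : Param d → ℝ} (hL : ContDiff ℝ ∞ L) : ContDiff ℝ 1 (∇ L) := by
  have h : ContDiff ℝ 1 (fderiv ℝ L) := hL.fderiv_right (by norm_cast)
  exact (InnerProductSpace.toDual ℝ (Param d)).symm.contDiff.comp h

theorem exists_lipschitz_gradient {L : Param d → ℝ} (hL : ContDiff ℝ ∞ L) (R : ℝ) :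
    ∃ ρ : ℝ, 0 < ρ ∧ ∀ x ∈ closedBall (0 : Param d) R, ∀ y ∈ closedBall (0 : Param d) R,
      ‖∇ L x - ∇ L y‖ ≤ ρ * ‖x - y‖ := by
  have h1 := contDiff_gradient hL
  obtain ⟨C, hC⟩ := (isCompact_closedBall (0 : Param d) R).exists_bound_of_continuousOn
    (h1.continuous_fderiv (by norm_num)).continuousOn
  refine ⟨max C 1, by positivity, fun x hx y hy => ?_⟩
  exact (convex_closedBall (0 : Param d) R).norm_image_sub_le_of_norm_fderiv_le
    (fun z _ => h1.differentiable (by norm_num) z)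
    (fun z hz => (hC z hz).trans (le_max_left _ _)) hy hx

/-- First order Taylor expansion with a quadratic remainder. -/
theorem abs_sub_sub_inner_gradient_le {L : Param d → ℝ} (hL : Differentiable ℝ L) {R ρ : ℝ}
    (hρ0 : 0 ≤ ρ)
    (hρ : ∀ x ∈ closedBall (0 : Param d) R, ∀ y ∈ closedBall (0 : Param d) R,
      ‖∇ L x - ∇ L y‖ ≤ ρ * ‖x - y‖) {x y : Param d}
    (hx : x ∈ closedBall (0 : Param d) R) (hy : y ∈ closedBall (0 : Param d) R) :
    |L y - L x - inner ℝ (∇ L x) (y - x)| ≤ ρ * ‖y - x‖ ^ 2 := by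
  have hseg : segment ℝ x y ⊆ closedBall (0 : Param d) R :=
    (convex_closedBall _ _).segment_subset hx hy
  have := (convex_segment (𝕜 := ℝ) x y).norm_image_sub_le_of_norm_fderiv_le'
    (f := L) (φ := fderiv ℝ L x) (C := ρ * ‖y - x‖)
    (fun z _ => hL z) (fun z hz => ?_) (left_mem_segment ℝ x y) (right_mem_segment ℝ x y)
  · rw [inner_gradient_left]
    calc _ ≤ _ := this
      _ = _ := by ring
  · rw [← toDual_gradient, ← toDual_gradient, ← map_sub, LinearIsometryEquiv.norm_map]
    refine (hρ z (hseg hz) x hx).trans ?_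
    gcongr
    obtain ⟨a, b, ha, hb, hab, rfl⟩ := hz
    have : a • x + b • y - x = b • (y - x) := by
      rw [← sub_eq_zero]; rw [eq_sub_of_add_eq hab]; module
    rw [this, norm_smul, Real.norm_of_nonneg hb]
    exact mul_le_of_le_one_left (norm_nonneg _) (by linarith)

/-- The directions tangent to a submanifold at the point `q` of a slice chart `e`. -/
theorem curve_in_slice {Γ : Set (Param d)} {e : OpenPartialHomeomorph (Param d) (Param d)}
    {W : Submodule ℝ (Param d)} (hes : ContDiffOn ℝ ∞ e.symm e.target)
    (he : e '' (e.source ∩ Γ) = e.target ∩ (W : Set (Param d)))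
    {q : Param d} (hq : q ∈ e.source) (hqΓ : q ∈ Γ) {w : Param d} (hw : w ∈ W) :
    (∀ᶠ t in 𝓝 (0 : ℝ), e.symm (e q + t • w) ∈ Γ) ∧
      HasDerivAt (fun t : ℝ => e.symm (e q + t • w)) (fderiv ℝ e.symm (e q) w) 0 := by
  have hqt : e q ∈ e.target := e.map_source hq
  have heqW : e q ∈ (W : Set (Param d)) := by
    have : e q ∈ e '' (e.source ∩ Γ) := ⟨q, ⟨hq, hqΓ⟩, rfl⟩
    rw [he] at this; exact this.2
  constructor
  · have hc : Tendsto (fun t : ℝ => e q + t • w) (𝓝 0) (𝓝 (e q)) := by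
      have : Continuous (fun t : ℝ => e q + t • w) := by fun_prop
      simpa using this.tendsto 0
    filter_upwards [hc (e.open_target.mem_nhds hqt)] with t ht
    have : e q + t • w ∈ e '' (e.source ∩ Γ) := by
      rw [he]; exact ⟨ht, W.add_mem heqW (W.smul_mem t hw)⟩
    obtain ⟨z, ⟨hz, hzΓ⟩, hzt⟩ := this
    rw [← hzt, e.left_inv hz]; exact hzΓ
  · have hd : DifferentiableAt ℝ e.symm (e q) :=
      (hes.contDiffAt (e.open_target.mem_nhds hqt)).differentiableAt (by simp)
    have h1 : HasDerivAt (fun t : ℝ => e q + t • w) w 0 := by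
      simpa using ((hasDerivAt_id (0 : ℝ)).smul_const w).const_add (e q)
    have h2 : HasFDerivAt e.symm (fderiv ℝ e.symm (e q)) (e q + (0 : ℝ) • w) := by
      simpa using hd.hasFDerivAt
    exact h2.comp_hasDerivAt (0 : ℝ) h1

theorem fderiv_symm_injective {e : OpenPartialHomeomorph (Param d) (Param d)}
    (hes : ContDiffOn ℝ ∞ e.symm e.target) (hec : ContDiffOn ℝ ∞ e e.source)
    {q : Param d} (hq : q ∈ e.source) :
    Function.Injective (fderiv ℝ e.symm (e q)) := by
  have hqt : e q ∈ e.target := e.map_source hq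
  have hd : DifferentiableAt ℝ e.symm (e q) :=
      (hes.contDiffAt (e.open_target.mem_nhds hqt)).differentiableAt (by simp)
  have hd' : DifferentiableAt ℝ e (e.symm (e q)) := by
    rw [e.left_inv hq]
    exact (hec.contDiffAt (e.open_source.mem_nhds hq)).differentiableAt (by simp)
  have h1 := hd'.hasFDerivAt.comp (e q) hd.hasFDerivAt
  have h2 : HasFDerivAt (e ∘ e.symm) (ContinuousLinearMap.id ℝ (Param d)) (e q) := by
    refine (hasFDerivAt_id (e q)).congr_of_eventuallyEq ?_
    filter_upwards [e.open_target.mem_nhds hqt] with z hz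
    simp [e.right_inv hz]
  have h3 := h1.unique h2
  intro a b hab
  have ha := congrArg (fun f : Param d →L[ℝ] Param d => f a) h3
  have hb := congrArg (fun f : Param d →L[ℝ] Param d => f b) h3
  simp only [ContinuousLinearMap.comp_apply, ContinuousLinearMap.id_apply] at ha hb
  rw [← ha, ← hb, hab]

/-- Where the gradient vanishes on a submanifold of codimension equal to the rank of the Hessian,
the kernel of the Hessian is the tangent space. -/
theorem ker_hessian_subset {L : Param d → ℝ} (hL : ContDiff ℝ ∞ L) {m : ℕ} {Γ : Set (Param d)}
    (hgrad : ∀ φ ∈ Γ, ∇ L φ = 0) {e : OpenPartialHomeomorph (Param d) (Param d)}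
    {W : Submodule ℝ (Param d)} (hW : Module.finrank ℝ W + m = d)
    (hec : ContDiffOn ℝ ∞ e e.source) (hes : ContDiffOn ℝ ∞ e.symm e.target)
    (he : e '' (e.source ∩ Γ) = e.target ∩ (W : Set (Param d)))
    {q : Param d} (hq : q ∈ e.source) (hqΓ : q ∈ Γ) (hrank : hessianRank L q = m)
    {v : Param d} (hv : fderiv ℝ (fun y => ∇ L y) q v = 0) :
    ∃ w ∈ W, fderiv ℝ e.symm (e q) w = v := by
  set A : Param d →ₗ[ℝ] Param d := (fderiv ℝ (fun y => ∇ L y) q : Param d →ₗ[ℝ] Param d) with hA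
  set S : Param d →ₗ[ℝ] Param d := (fderiv ℝ e.symm (e q) : Param d →ₗ[ℝ] Param d) with hS
  have hinj : Function.Injective S := fderiv_symm_injective hes hec hq
  -- Differentiating `∇ L = 0` along curves in `Γ` puts the tangent space inside the kernel;
  -- rank–nullity gives both the dimension `d - m`, so they coincide.
  have hle : W.map S ≤ LinearMap.ker A := by
    rintro _ ⟨w, hw, rfl⟩
    obtain ⟨hmem, hder⟩ := curve_in_slice hes he hq hqΓ hw
    have hgd : HasFDerivAt (fun y => ∇ L y) (fderiv ℝ (fun y => ∇ L y) q)
        (e.symm (e q + (0 : ℝ) • w)) := by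
      simpa [e.left_inv hq] using
        (((contDiff_gradient hL).differentiable (by norm_num)) q).hasFDerivAt
    have h1 := hgd.comp_hasDerivAt (0 : ℝ) hder
    have h2 : HasDerivAt ((fun y => ∇ L y) ∘ fun t : ℝ => e.symm (e q + t • w)) 0 0 := by
      refine (hasDerivAt_const (0 : ℝ) (0 : Param d)).congr_of_eventuallyEq ?_
      filter_upwards [hmem] with t ht
      exact hgrad _ ht
    exact h1.unique h2
  have hdim : Module.finrank ℝ (W.map S) = Module.finrank ℝ (LinearMap.ker A) := by
    rw [← (Submodule.equivMapOfInjective S hinj W).finrank_eq]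
    have h1 := LinearMap.finrank_range_add_finrank_ker A
    have h2 : Module.finrank ℝ (LinearMap.range A) = m := hrank
    rw [h2, finrank_euclideanSpace, Fintype.card_fin] at h1
    omega
  have heq := Submodule.eq_of_le_of_finrank_eq hle hdim
  have hvk : v ∈ LinearMap.ker A := hv
  rw [← heq] at hvk
  obtain ⟨w, hw, hwv⟩ := hvk
  exact ⟨w, hw, hwv⟩

/-- First-order optimality: the squared distance to `θ` along a curve in `Γ` through the nearest
point `q` is minimal at `q`, so `θ - q` is normal to `Γ`. -/
theorem inner_sub_nearest_eq_zero {Γ : Set (Param d)}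
    {e : OpenPartialHomeomorph (Param d) (Param d)}
    {W : Submodule ℝ (Param d)} (hes : ContDiffOn ℝ ∞ e.symm e.target)
    (he : e '' (e.source ∩ Γ) = e.target ∩ (W : Set (Param d)))
    {q θ : Param d} (hq : q ∈ e.source) (hqΓ : q ∈ Γ) (hmin : infDist θ Γ = dist θ q)
    {w : Param d} (hw : w ∈ W) : inner ℝ (θ - q) (fderiv ℝ e.symm (e q) w) = 0 := by
  obtain ⟨hmem, hder⟩ := curve_in_slice hes he hq hqΓ hw
  have h1 := (hder.const_sub θ).norm_sq
  have h2 : IsLocalMin (fun t : ℝ => ‖θ - e.symm (e q + t • w)‖ ^ 2) 0 := by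
    filter_upwards [hmem] with t ht
    have : dist θ q ≤ dist θ (e.symm (e q + t • w)) := hmin ▸ infDist_le_dist_of_mem ht
    simp only [zero_smul, add_zero, e.left_inv hq]
    rw [dist_eq_norm, dist_eq_norm] at this
    gcongr
  have h3 := h2.hasDerivAt_eq_zero h1
  simpa [e.left_inv hq] using h3

/-- Near the minimizing manifold, the gradient is bounded below by the distance. -/
theorem exists_mul_infDist_le_norm_gradient {L : Param d → ℝ} (hL : ContDiff ℝ ∞ L) {m : ℕ}
    {Γ : Set (Param d)} (hmfd : IsSmoothSubmanifold m Γ) (hcpt : IsCompact Γ) (hne : Γ.Nonempty)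
    (hrank : ∀ φ ∈ Γ, hessianRank L φ = m) (hgrad : ∀ φ ∈ Γ, ∇ L φ = 0) :
    ∃ μ > 0, ∃ ε > 0, ∀ θ, infDist θ Γ < ε → μ * infDist θ Γ ≤ ‖∇ L θ‖ := by
  -- Blow-up by compactness: along counterexamples tending to `Γ`, the unit directions `u n` from
  -- the nearest points subconverge to a unit vector `v`. The Hessian kills `v`, so `v` is tangent;
  -- each `u n` is normal, so in the limit `v` is orthogonal to itself.
  by_contra! hcon
  choose θ hθε hθ using fun n : ℕ => hcon (1 / ((n : ℝ) + 1)) (by positivity)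
    (1 / ((n : ℝ) + 1)) (by positivity)
  choose q hqΓ hq using fun n => hcpt.exists_infDist_eq_dist hne (θ n)
  have hpos : ∀ n, 0 < dist (θ n) (q n) := by
    intro n
    rcases (dist_nonneg (x := θ n) (y := q n)).lt_or_eq with h | h
    · exact h
    · have := hθ n
      rw [hq n, ← h, mul_zero] at this
      exact absurd this (norm_nonneg _).not_gt
  set u : ℕ → Param d := fun n => (dist (θ n) (q n))⁻¹ • (θ n - q n) with hu
  have hu1 : ∀ n, u n ∈ sphere (0 : Param d) 1 := by
    intro n
    have := (hpos n).ne'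
    simp only [hu, mem_sphere_iff_norm, sub_zero, norm_smul, norm_inv,
      Real.norm_of_nonneg dist_nonneg]
    rw [← dist_eq_norm, inv_mul_cancel₀ this]
  obtain ⟨⟨φ, v⟩, ⟨hφ, hv⟩, σ, hσ, hlim⟩ :=
    (hcpt.prod (isCompact_sphere (0 : Param d) 1)).tendsto_subseq
      (x := fun n => (q n, u n)) (fun n => ⟨hqΓ n, hu1 n⟩)
  have hqlim : Tendsto (fun n => q (σ n)) atTop (𝓝 φ) := (continuous_fst.tendsto _).comp hlim
  have hulim : Tendsto (fun n => u (σ n)) atTop (𝓝 v) := (continuous_snd.tendsto _).comp hlim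
  have hinv : Tendsto (fun n => 1 / (((σ n : ℕ) : ℝ) + 1)) atTop (𝓝 0) :=
    (tendsto_one_div_add_atTop_nhds_zero_nat (𝕜 := ℝ)).comp hσ.tendsto_atTop
  have hdlim : Tendsto (fun n => θ (σ n) - q (σ n)) atTop (𝓝 0) := by
    refine squeeze_zero_norm (fun n => ?_) hinv
    rw [← dist_eq_norm, ← hq]; exact (hθε _).le
  have hθlim : Tendsto (fun n => θ (σ n)) atTop (𝓝 φ) := by
    simpa using hdlim.add hqlim
  set A := fderiv ℝ (fun y => ∇ L y) φ with hA
  have hstrict : HasStrictFDerivAt (fun y => ∇ L y) A φ :=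
    (contDiff_gradient hL).contDiffAt.hasStrictFDerivAt (by norm_num)
  have hAv : A v = 0 := by
    have hAlim : Tendsto (fun n => ‖A (u (σ n))‖) atTop (𝓝 ‖A v‖) :=
      ((A.continuous.tendsto v).comp hulim).norm
    rw [← norm_le_zero_iff]
    refine le_of_forall_pos_le_add fun c hc => ?_
    refine le_of_tendsto hAlim ?_
    have h1 := (hstrict.isLittleO.comp_tendsto (hθlim.prodMk_nhds hqlim)).def (half_pos hc)
    filter_upwards [h1, hinv.eventually (gt_mem_nhds (half_pos hc))] with n hn1 hn2
    simp only [Function.comp_apply, hgrad _ (hqΓ _), sub_zero] at hn1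
    have h2 : ‖A (θ (σ n) - q (σ n))‖ ≤ c * dist (θ (σ n)) (q (σ n)) := by
      have h3 : ‖A (θ (σ n) - q (σ n))‖ ≤ ‖∇ L (θ (σ n))‖ +
          ‖∇ L (θ (σ n)) - A (θ (σ n) - q (σ n))‖ := by
        have := norm_sub_le (∇ L (θ (σ n))) (∇ L (θ (σ n)) - A (θ (σ n) - q (σ n)))
        simpa using this
      have h4 := hθ (σ n)
      rw [hq] at h4
      rw [← dist_eq_norm (θ (σ n)) (q (σ n))] at hn1
      have h5 := mul_le_mul_of_nonneg_right hn2.le (hpos (σ n)).le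
      linarith
    rw [zero_add]
    simp only [hu, map_smul, norm_smul, norm_inv, Real.norm_of_nonneg dist_nonneg]
    rw [inv_mul_le_iff₀ (hpos _), mul_comm]
    exact h2
  obtain ⟨e, W, hW, hφe, hec, hes, he⟩ := hmfd φ hφ
  obtain ⟨w, hw, hwv⟩ := ker_hessian_subset hL hgrad hW hec hes he hφe hφ (hrank φ hφ) hAv
  have hSlim : Tendsto (fun n => fderiv ℝ e.symm (e (q (σ n))) w) atTop (𝓝 v) := by
    rw [← hwv]
    have h1 : ContinuousAt (fderiv ℝ e.symm) (e φ) :=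
      (hes.contDiffAt (e.open_target.mem_nhds (e.map_source hφe))).continuousAt_fderiv (by simp)
    have h2 : Tendsto (fun n => fderiv ℝ e.symm (e (q (σ n)))) atTop
        (𝓝 (fderiv ℝ e.symm (e φ))) :=
      h1.tendsto.comp ((e.continuousAt hφe).tendsto.comp hqlim)
    exact ((ContinuousLinearMap.apply ℝ (Param d) w).continuous.tendsto _).comp h2
  have hin : Tendsto (fun n => inner ℝ (u (σ n)) (fderiv ℝ e.symm (e (q (σ n))) w)) atTop
      (𝓝 (inner ℝ v v)) := hulim.inner hSlim
  have hz : Tendsto (fun n => inner ℝ (u (σ n)) (fderiv ℝ e.symm (e (q (σ n))) w)) atTop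
      (𝓝 0) := by
    refine tendsto_const_nhds.congr' ?_
    filter_upwards [hqlim (e.open_source.mem_nhds hφe)] with n hn
    simp only [hu, real_inner_smul_left]
    rw [inner_sub_nearest_eq_zero hes he hn (hqΓ _) (hq _) hw, mul_zero]
  have hvv := tendsto_nhds_unique hin hz
  rw [real_inner_self_eq_norm_sq] at hvv
  rw [mem_sphere_iff_norm, sub_zero] at hv
  rw [hv] at hvv
  norm_num at hvv

/-- Quantitative form of the Polyak–Łojasiewicz geometry of `L` in the `ε`-neighbourhood of its
minimizing manifold `Γ`, on which `L` takes the value `Lmin`. -/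
structure IsPLNeighborhood (L : Param d → ℝ) (Γ : Set (Param d)) (Lmin ε κ c ρ : ℝ) : Prop where
  eps_pos : 0 < ε
  kappa_pos : 0 < κ
  c_pos : 0 < c
  rho_pos : 0 < ρ
  eq_min : ∀ φ ∈ Γ, L φ = Lmin
  growth : ∀ θ, infDist θ Γ < ε → κ * infDist θ Γ ^ 2 ≤ L θ - Lmin
  pl : ∀ θ, infDist θ Γ < ε → c * (L θ - Lmin) ≤ ‖∇ L θ‖ ^ 2
  grad_le : ∀ θ, infDist θ Γ < ε → ‖∇ L θ‖ ^ 2 ≤ 4 * ρ * (L θ - Lmin)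
  taylor : ∀ x y, infDist x Γ < ε → infDist y Γ < ε →
    L y - L x ≤ inner ℝ (∇ L x) (y - x) + ρ * ‖y - x‖ ^ 2

/-- Both `L - Lmin` and `‖∇ L‖²` are comparable with the squared distance to `Γ`: from above by
Taylor expansion at the nearest point, from below by the linear lower bound on the gradient. -/
theorem exists_isPLNeighborhood {L : Param d → ℝ} (hL : ContDiff ℝ ∞ L) {m : ℕ}
    {Γ : Set (Param d)} (hmfd : IsSmoothSubmanifold m Γ) (hcpt : IsCompact Γ) (hne : Γ.Nonempty)
    (hrank : ∀ φ ∈ Γ, hessianRank L φ = m)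
    (hmin : ∃ U : Set (Param d), IsOpen U ∧ Γ = {θ ∈ U | ∀ θ' ∈ U, L θ ≤ L θ'}) :
    ∃ Lmin ε κ c ρ : ℝ, IsPLNeighborhood L Γ Lmin ε κ c ρ := by
  obtain ⟨U, hU, hΓU⟩ := hmin
  have hsub : Γ ⊆ U := by rw [hΓU]; exact sep_subset _ _
  have hle : ∀ φ ∈ Γ, ∀ θ ∈ U, L φ ≤ L θ := by
    intro φ hφ; rw [hΓU] at hφ; exact hφ.2
  have hLd : Differentiable ℝ L := hL.differentiable (by simp)
  have hgrad : ∀ φ ∈ Γ, ∇ L φ = 0 := by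
    intro φ hφ
    have : IsLocalMin L φ := by
      filter_upwards [hU.mem_nhds (hsub hφ)] with θ hθ using hle φ hφ θ hθ
    simp [gradient, this.fderiv_eq_zero]
  obtain ⟨μ, hμ, ε₁, hε₁, hlow⟩ := exists_mul_infDist_le_norm_gradient hL hmfd hcpt hne hrank hgrad
  obtain ⟨ε₂, hε₂, hthick⟩ := hcpt.exists_thickening_subset_open hU hsub
  obtain ⟨R, hR⟩ := hcpt.isBounded.subset_closedBall (0 : Param d)
  obtain ⟨ρ, hρ, hlip⟩ := exists_lipschitz_gradient hL (R + ε₂)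
  obtain ⟨φ₀, hφ₀⟩ := hne
  -- The factor two leaves room for the gradient step used in `hgrad_le`, whose length is at most
  -- the distance to `Γ`.
  set ε := min ε₁ (ε₂ / 2) with hε
  have hεpos : 0 < ε := by positivity
  have hU' : ∀ θ, infDist θ Γ < ε₂ → θ ∈ U := fun θ h =>
    hthick ((mem_thickening_iff_infDist_lt ⟨φ₀, hφ₀⟩).2 h)
  have hball : ∀ θ, infDist θ Γ < ε₂ → θ ∈ closedBall (0 : Param d) (R + ε₂) := by
    intro θ h
    obtain ⟨q, hq, hdq⟩ := (infDist_lt_iff ⟨φ₀, hφ₀⟩).1 h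
    have h1 := hR hq
    rw [mem_closedBall] at h1 ⊢
    linarith [dist_triangle θ q 0]
  have hε2 : ∀ {r}, r < ε → r < ε₂ := fun h =>
    h.trans_le ((min_le_right _ _).trans (by linarith))
  have heq : ∀ φ ∈ Γ, L φ = L φ₀ := fun φ hφ =>
    le_antisymm (hle φ hφ _ (hsub hφ₀)) (hle _ hφ₀ _ (hsub hφ))
  have hgle : ∀ θ, infDist θ Γ < ε → ‖∇ L θ‖ ≤ ρ * infDist θ Γ := by
    intro θ h
    obtain ⟨q, hq, hdq⟩ := hcpt.exists_infDist_eq_dist ⟨φ₀, hφ₀⟩ θ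
    have := hlip θ (hball θ (hε2 h)) q (hball q (by rw [infDist_zero_of_mem hq]; exact hε₂))
    rwa [hgrad q hq, sub_zero, ← dist_eq_norm, ← hdq] at this
  have hup : ∀ θ, infDist θ Γ < ε → L θ - L φ₀ ≤ ρ * infDist θ Γ ^ 2 := by
    intro θ h
    obtain ⟨q, hq, hdq⟩ := hcpt.exists_infDist_eq_dist ⟨φ₀, hφ₀⟩ θ
    have := abs_sub_sub_inner_gradient_le hLd hρ.le hlip
      (hball q (by rw [infDist_zero_of_mem hq]; exact hε₂)) (hball θ (hε2 h))
    rw [hgrad q hq, inner_zero_left, sub_zero, ← dist_eq_norm, ← hdq, heq q hq] at this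
    exact (le_abs_self _).trans this
  have hgrad_le : ∀ θ, infDist θ Γ < ε → ‖∇ L θ‖ ^ 2 ≤ 4 * ρ * (L θ - L φ₀) := by
    intro θ h
    -- A gradient step with this rate lowers `L` by at least `‖∇ L θ‖² / (4ρ)`, yet cannot go below
    -- the minimum over `U`.
    set y := θ - (2 * ρ)⁻¹ • ∇ L θ with hy
    have hyn : y - θ = -((2 * ρ)⁻¹ • ∇ L θ) := by rw [hy]; abel
    have hynorm : ‖y - θ‖ = (2 * ρ)⁻¹ * ‖∇ L θ‖ := by
      rw [hyn, norm_neg, norm_smul, Real.norm_of_nonneg (by positivity)]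
    have hyd : infDist y Γ < ε₂ := by
      have h1 : infDist y Γ ≤ infDist θ Γ + dist y θ := infDist_le_infDist_add_dist
      rw [dist_eq_norm, hynorm] at h1
      have h2 : (2 * ρ)⁻¹ * ‖∇ L θ‖ ≤ infDist θ Γ := by
        rw [inv_mul_le_iff₀ (by positivity)]
        nlinarith [hgle θ h, infDist_nonneg (x := θ) (s := Γ)]
      have h3 : ε ≤ ε₂ / 2 := min_le_right _ _
      linarith
    have h1 := (le_abs_self _).trans
      (abs_sub_sub_inner_gradient_le hLd hρ.le hlip (hball θ (hε2 h)) (hball y hyd))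
    have h2 := hle φ₀ hφ₀ y (hU' y hyd)
    rw [hynorm, hyn, inner_neg_right, inner_smul_right, real_inner_self_eq_norm_sq] at h1
    have h3 : ρ * ((2 * ρ)⁻¹ * ‖∇ L θ‖) ^ 2 - (2 * ρ)⁻¹ * ‖∇ L θ‖ ^ 2
        = - (‖∇ L θ‖ ^ 2 / (4 * ρ)) := by
      field_simp; ring
    have h4 : ‖∇ L θ‖ ^ 2 / (4 * ρ) ≤ L θ - L φ₀ := by linarith
    rw [div_le_iff₀ (by positivity)] at h4
    linarith
  have hlow2 : ∀ θ, infDist θ Γ < ε → μ ^ 2 * infDist θ Γ ^ 2 ≤ ‖∇ L θ‖ ^ 2 := by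
    intro θ h
    rw [← mul_pow]
    have := hlow θ (h.trans_le (min_le_left _ _))
    have h0 := infDist_nonneg (x := θ) (s := Γ)
    gcongr
  refine ⟨L φ₀, ε, μ ^ 2 / (4 * ρ), μ ^ 2 / ρ, ρ, hεpos, by positivity, by positivity, hρ, heq,
    fun θ h => ?_, fun θ h => ?_, hgrad_le, fun x y hx hy => ?_⟩
  · rw [div_mul_eq_mul_div, div_le_iff₀ (by positivity)]
    linarith [hlow2 θ h, hgrad_le θ h]
  · refine le_trans ?_ (hlow2 θ h)
    rw [div_mul_eq_mul_div, div_le_iff₀ hρ]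
    nlinarith [hup θ h, sq_nonneg μ]
  · have := (le_abs_self _).trans (abs_sub_sub_inner_gradient_le hLd hρ.le hlip
      (hball x (hε2 hx)) (hball y (hε2 hy)))
    linarith

namespace IsPLNeighborhood

variable {L : Param d → ℝ} {Γ : Set (Param d)} {Lmin ε κ c ρ : ℝ}

theorem nonneg (h : IsPLNeighborhood L Γ Lmin ε κ c ρ) {θ : Param d} (hθ : infDist θ Γ < ε) :
    0 ≤ L θ - Lmin :=
  (mul_nonneg h.kappa_pos.le (sq_nonneg _)).trans (h.growth θ hθ)

theorem infDist_le (h : IsPLNeighborhood L Γ Lmin ε κ c ρ) {θ : Param d}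
    (hθ : infDist θ Γ < ε) : infDist θ Γ ≤ √(L θ - Lmin) / √κ := by
  rw [← Real.sqrt_div (h.nonneg hθ)]
  apply Real.le_sqrt_of_sq_le
  rw [le_div_iff₀ h.kappa_pos, mul_comm]
  exact h.growth θ hθ

theorem norm_gradient_le (h : IsPLNeighborhood L Γ Lmin ε κ c ρ) {θ : Param d}
    (hθ : infDist θ Γ < ε) : ‖∇ L θ‖ ≤ 2 * √ρ * √(L θ - Lmin) := by
  have h1 := h.grad_le θ hθ
  refine abs_le_of_sq_le_sq' ?_ (by positivity) |>.2
  rw [mul_pow, mul_pow, Real.sq_sqrt h.rho_pos.le, Real.sq_sqrt (h.nonneg hθ)]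
  linarith

/-- Inserting `‖∇ L x‖ ≤ 2 √ρ √(L x - Lmin)` into the Taylor bound completes a square. As a result,
displacements enter the potential additively. -/
theorem sqrt_sub_le (h : IsPLNeighborhood L Γ Lmin ε κ c ρ) {x y : Param d}
    (hx : infDist x Γ < ε) (hy : infDist y Γ < ε) :
    √(L y - Lmin) ≤ √(L x - Lmin) + √ρ * ‖y - x‖ := by
  rw [Real.sqrt_le_left (by positivity)]
  have h1 := h.taylor x y hx hy
  have h2 := (real_inner_le_norm (∇ L x) (y - x)).trans
    (mul_le_mul_of_nonneg_right (h.norm_gradient_le hx) (norm_nonneg _))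
  have h3 := Real.sq_sqrt h.rho_pos.le
  have h4 := Real.sq_sqrt (h.nonneg hx)
  nlinarith

end IsPLNeighborhood

/-! ### Gradient flows: existence, decay and convergence. -/

/-- `x` solves the gradient flow equation of `L` on `[0, ∞)`. -/
def IsGradientFlow (L : Param d → ℝ) (x : ℝ → Param d) : Prop :=
  ∀ t : ℝ, 0 ≤ t → HasDerivWithinAt x (-(∇ L (x t))) (Ici 0) t

/-- The speed is at most `G`, so the ball of radius `G * T` is large enough for Picard–Lindelöf on
all of `[0, T]`, however large `T` is. -/
theorem exists_gradientFlow_Icc {L : Param d → ℝ} (hL : ContDiff ℝ ∞ L) {G : ℝ}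
    (hG : ∀ θ, ‖∇ L θ‖ ≤ G) (θ : Param d) {T : ℝ} (hT : 0 ≤ T) :
    ∃ x : ℝ → Param d, x 0 = θ ∧
      ∀ t ∈ Icc 0 T, HasDerivWithinAt x (-(∇ L (x t))) (Icc 0 T) t := by
  have hG0 : 0 ≤ G := (norm_nonneg _).trans (hG θ)
  obtain ⟨ρ, hρ, hlip⟩ := exists_lipschitz_gradient hL (‖θ‖ + G * T)
  have hball : closedBall θ (G * T) ⊆ closedBall 0 (‖θ‖ + G * T) :=
    closedBall_subset_closedBall' (by rw [dist_zero_right]; linarith)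
  have hpl : IsPicardLindelof (fun _ y => -(∇ L y)) (tmin := 0) (tmax := T)
      ⟨0, left_mem_Icc.2 hT⟩ θ ⟨G * T, by positivity⟩ 0 ⟨G, hG0⟩ ⟨ρ, hρ.le⟩ :=
    { lipschitzOnWith := fun t _ => by
        refine LipschitzOnWith.of_dist_le_mul fun x hx y hy => ?_
        rw [dist_neg_neg, dist_eq_norm, dist_eq_norm]
        exact hlip x (hball hx) y (hball hy)
      continuousOn := fun x _ => continuousOn_const
      norm_le := fun t _ x _ => by rw [norm_neg]; exact hG x
      mul_max_le := by 
        simp only [sub_zero, sub_self, max_eq_left hT]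
        exact (sub_zero (G * T)).ge }
  exact hpl.exists_eq_forall_mem_Icc_hasDerivWithinAt₀

theorem gradientFlow_Icc_unique {L : Param d → ℝ} (hL : ContDiff ℝ ∞ L) {G : ℝ}
    (hG : ∀ θ, ‖∇ L θ‖ ≤ G) {T : ℝ} {x y : ℝ → Param d} (h0 : x 0 = y 0)
    (hx : ∀ t ∈ Icc 0 T, HasDerivWithinAt x (-(∇ L (x t))) (Icc 0 T) t)
    (hy : ∀ t ∈ Icc 0 T, HasDerivWithinAt y (-(∇ L (y t))) (Icc 0 T) t) :
    EqOn x y (Icc 0 T) := by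
  have hG0 : 0 ≤ G := (norm_nonneg _).trans (hG 0)
  obtain ⟨ρ, hρ, hlip⟩ := exists_lipschitz_gradient hL (‖x 0‖ + G * T)
  have hmem : ∀ z : ℝ → Param d, z 0 = x 0 →
      (∀ t ∈ Icc 0 T, HasDerivWithinAt z (-(∇ L (z t))) (Icc 0 T) t) →
      ∀ t ∈ Ico 0 T, z t ∈ closedBall (0 : Param d) (‖x 0‖ + G * T) := by
    intro z hz0 hz t ht
    have h1 := norm_image_sub_le_of_norm_deriv_le_segment' hz
      (fun t _ => by rw [norm_neg]; exact hG _) t (Ico_subset_Icc_self ht)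
    rw [mem_closedBall_zero_iff]
    have h2 := norm_le_insert' (z t) (z 0)
    have h3 : G * (t - 0) ≤ G * T := by gcongr; linarith [ht.2]
    rw [hz0] at h1 h2
    linarith
  have hright : ∀ z : ℝ → Param d,
      (∀ t ∈ Icc 0 T, HasDerivWithinAt z (-(∇ L (z t))) (Icc 0 T) t) →
      ∀ t ∈ Ico 0 T, HasDerivWithinAt z (-(∇ L (z t))) (Ici t) t := fun z hz t ht =>
    (hz t (Ico_subset_Icc_self ht)).mono_of_mem_nhdsWithin (Icc_mem_nhdsGE_of_mem ht)
  refine ODE_solution_unique_of_mem_Icc_right (K := ⟨ρ, hρ.le⟩) (v := fun _ y => -(∇ L y))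
    (s := fun _ => closedBall (0 : Param d) (‖x 0‖ + G * T)) (fun t _ => ?_)
    (fun t ht => (hx t ht).continuousWithinAt) (hright x hx) (hmem x rfl hx)
    (fun t ht => (hy t ht).continuousWithinAt) (hright y hy) (hmem y h0.symm hy) h0
  refine LipschitzOnWith.of_dist_le_mul fun x hx y hy => ?_
  rw [dist_neg_neg, dist_eq_norm, dist_eq_norm]
  exact hlip x hx y hy

/-- A smooth function with bounded gradient has global gradient flows. -/
theorem exists_isGradientFlow {L : Param d → ℝ} (hL : ContDiff ℝ ∞ L) {G : ℝ}
    (hG : ∀ θ, ‖∇ L θ‖ ≤ G) (θ : Param d) : ∃ x : ℝ → Param d, x 0 = θ ∧ IsGradientFlow L x := by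
  choose X hX0 hX using fun n : ℕ =>
    exists_gradientFlow_Icc hL hG θ (T := (n : ℝ) + 1) (by positivity)
  have hcompat : ∀ n N : ℕ, n ≤ N → EqOn (X n) (X N) (Icc 0 ((n : ℝ) + 1)) := by
    intro n N hnN
    have hsub : Icc (0 : ℝ) ((n : ℝ) + 1) ⊆ Icc 0 ((N : ℝ) + 1) :=
      Icc_subset_Icc_right (by gcongr)
    exact gradientFlow_Icc_unique hL hG ((hX0 n).trans (hX0 N).symm) (hX n)
      (fun t ht => (hX N t (hsub ht)).mono hsub)
  have hglue : ∀ N : ℕ, ∀ t ∈ Icc (0 : ℝ) N, X ⌈t⌉₊ t = X N t := fun N t ht =>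
    hcompat _ _ (Nat.ceil_le.2 ht.2) ⟨ht.1, (Nat.le_ceil t).trans (by linarith)⟩
  -- Uniqueness makes the solutions on `[0, n + 1]` compatible, so near each `t` the glued curve
  -- agrees with one fixed `X N`.
  refine ⟨fun t => X ⌈t⌉₊ t, by simp [hX0], fun t ht => ?_⟩
  obtain ⟨N, hN⟩ := exists_nat_gt t
  have h1 : HasDerivWithinAt (X N) (-(∇ L (X N t))) (Ici 0) t :=
    (hX N t ⟨ht, by linarith⟩).mono_of_mem_nhdsWithin
      (mem_nhdsWithin.2 ⟨Iio ((N : ℝ) + 1), isOpen_Iio, by simp; linarith,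
        fun z hz => ⟨hz.2, (le_of_lt hz.1)⟩⟩)
  have h2 : X ⌈t⌉₊ t = X N t := hglue N t ⟨ht, hN.le⟩
  simp only [h2]
  refine h1.congr_of_eventuallyEq ?_ h2
  refine mem_nhdsWithin.2 ⟨Iio (N : ℝ), isOpen_Iio, hN, fun z hz => ?_⟩
  exact hglue N z ⟨hz.2, le_of_lt hz.1⟩

namespace IsGradientFlow

variable {L : Param d → ℝ} {x : ℝ → Param d}

theorem continuousOn (hx : IsGradientFlow L x) : ContinuousOn x (Ici 0) :=
  fun t ht => (hx t ht).continuousWithinAt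

theorem hasDerivWithinAt_Ici (hx : IsGradientFlow L x) {t : ℝ} (ht : 0 ≤ t) :
    HasDerivWithinAt x (-(∇ L (x t))) (Ici t) t :=
  (hx t ht).mono (Ici_subset_Ici.2 ht)

theorem shift (hx : IsGradientFlow L x) {s : ℝ} (hs : 0 ≤ s) :
    IsGradientFlow L (fun t => x (t + s)) := by
  intro t ht
  have h1 : HasDerivWithinAt (fun t : ℝ => t + s) 1 (Ici 0) t :=
    ((hasDerivAt_id t).add_const s).hasDerivWithinAt
  have h2 := (hx (t + s) (by linarith)).scomp t h1
    (fun z (hz : 0 ≤ z) => show 0 ≤ z + s by linarith)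
  rw [one_smul] at h2
  exact h2

theorem norm_sub_le (hx : IsGradientFlow L x) {G : ℝ} (hG : ∀ θ, ‖∇ L θ‖ ≤ G) {s t : ℝ}
    (hs : 0 ≤ s) (hst : s ≤ t) : ‖x t - x s‖ ≤ G * (t - s) := by
  refine norm_image_sub_le_of_norm_deriv_right_le_segment
    (hx.continuousOn.mono fun z hz => hs.trans hz.1)
    (fun z hz => hx.hasDerivWithinAt_Ici (hs.trans hz.1))
    (fun z _ => by rw [norm_neg]; exact hG _) t ⟨hst, le_rfl⟩

theorem hasDerivAt_comp (hx : IsGradientFlow L x) (hL : Differentiable ℝ L) {t : ℝ} (ht : 0 < t) :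
    HasDerivAt (fun t => L (x t)) (-‖∇ L (x t)‖ ^ 2) t := by
  have h1 : HasDerivAt x (-(∇ L (x t))) t := (hx t ht.le).hasDerivAt (Ici_mem_nhds ht)
  have h2 := (hL (x t)).hasFDerivAt.comp_hasDerivAt t h1
  rw [← inner_gradient_left, inner_neg_right, real_inner_self_eq_norm_sq] at h2
  exact h2

theorem antitoneOn (hx : IsGradientFlow L x) (hL : Differentiable ℝ L) :
    AntitoneOn (fun t => L (x t)) (Ici 0) := by
  refine antitoneOn_of_deriv_nonpos (convex_Ici 0)
    (hL.continuous.comp_continuousOn hx.continuousOn) ?_ ?_ <;> rw [interior_Ici] <;> intro t ht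
  · exact (hx.hasDerivAt_comp hL ht).differentiableAt.differentiableWithinAt
  · rw [(hx.hasDerivAt_comp hL ht).deriv]; nlinarith [sq_nonneg ‖∇ L (x t)‖]

variable {Γ : Set (Param d)} {Lmin ε κ c ρ : ℝ}

/-- Barrier argument: before leaving the tube the flow would be at distance exactly `ε / 2`, but
there quadratic growth and the decrease of `L` force a distance below `ε / 2`. -/
theorem infDist_lt (hx : IsGradientFlow L x) (hL : Differentiable ℝ L)
    (h : IsPLNeighborhood L Γ Lmin ε κ c ρ) (h0 : infDist (x 0) Γ < ε)
    (h1 : √(L (x 0) - Lmin) / √κ < ε / 2) {t : ℝ} (ht : 0 ≤ t) : infDist (x t) Γ < ε := by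
  by_contra! hcon
  have hcont : ContinuousOn (fun t => infDist (x t) Γ) (Icc 0 t) :=
    (continuous_infDist_pt Γ).comp_continuousOn (hx.continuousOn.mono Icc_subset_Ici_self)
  have hε := h.eps_pos
  obtain ⟨s, hs, hsε⟩ := intermediate_value_Icc ht hcont
    (show ε / 2 ∈ Icc _ _ from ⟨((h.infDist_le h0).trans h1.le), by linarith⟩)
  simp only at hsε
  have h2 := h.infDist_le (θ := x s) (by linarith)
  have h3 : √(L (x s) - Lmin) / √κ ≤ √(L (x 0) - Lmin) / √κ := by
    gcongr
    exact hx.antitoneOn hL (mem_Ici.2 le_rfl) hs.1 hs.1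
  linarith

/-- By the Polyak–Łojasiewicz inequality, `exp (c t) (L (x t) - Lmin)` is nonincreasing. -/
theorem sqrt_le (hx : IsGradientFlow L x) (hL : Differentiable ℝ L)
    (h : IsPLNeighborhood L Γ Lmin ε κ c ρ) (h0 : infDist (x 0) Γ < ε)
    (h1 : √(L (x 0) - Lmin) / √κ < ε / 2) {t : ℝ} (ht : 0 ≤ t) :
    √(L (x t) - Lmin) ≤ Real.exp (-(c / 2) * t) * √(L (x 0) - Lmin) := by
  have hd : ∀ s, 0 < s → HasDerivAt (fun t => Real.exp (c * t) * (L (x t) - Lmin))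
      (Real.exp (c * s) * c * (L (x s) - Lmin) + Real.exp (c * s) * (-‖∇ L (x s)‖ ^ 2)) s := by
    intro s hs
    have h2 : HasDerivAt (fun t => Real.exp (c * t)) (Real.exp (c * s) * c) s := by
      simpa using ((hasDerivAt_id s).const_mul c).exp
    exact h2.mul ((hx.hasDerivAt_comp hL hs).sub_const Lmin)
  have hanti : AntitoneOn (fun t => Real.exp (c * t) * (L (x t) - Lmin)) (Ici 0) := by
    refine antitoneOn_of_deriv_nonpos (convex_Ici 0) ?_ ?_ ?_
    · refine ContinuousOn.mul (by fun_prop) ?_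
      exact (hL.continuous.comp_continuousOn hx.continuousOn).sub continuousOn_const
    · rw [interior_Ici]
      exact fun s hs => (hd s hs).differentiableAt.differentiableWithinAt
    · rw [interior_Ici]
      intro s hs
      rw [(hd s hs).deriv]
      have h2 := h.pl (x s) (hx.infDist_lt hL h h0 h1 (le_of_lt hs))
      have h3 := (Real.exp_pos (c * s)).le
      nlinarith
  have h2 := hanti (mem_Ici.2 le_rfl) (mem_Ici.2 ht) ht
  simp only [mul_zero, Real.exp_zero, one_mul] at h2
  rw [Real.sqrt_le_left (by positivity), mul_pow, Real.sq_sqrt (h.nonneg h0), ← Real.exp_nat_mul]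
  have h3 : Real.exp ((2 : ℕ) * (-(c / 2) * t)) = (Real.exp (c * t))⁻¹ := by
    rw [← Real.exp_neg]; congr 1; push_cast; ring
  rw [h3, ← div_eq_inv_mul, le_div_iff₀ (Real.exp_pos _)]
  linarith

/-- The speed is at most `2 √ρ √(L - Lmin)`, which decays at rate `c / 2`; integrating it bounds the
remaining length of the trajectory. -/
theorem norm_sub_le_exp (hx : IsGradientFlow L x) (hL : Differentiable ℝ L)
    (h : IsPLNeighborhood L Γ Lmin ε κ c ρ) (h0 : infDist (x 0) Γ < ε)
    (h1 : √(L (x 0) - Lmin) / √κ < ε / 2) {s t : ℝ} (hs : 0 ≤ s) (hst : s ≤ t) :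
    ‖x t - x s‖ ≤ 4 * √ρ / c * √(L (x 0) - Lmin) * Real.exp (-(c / 2) * s) := by
  have hc := h.c_pos
  set A := 4 * √ρ / c * √(L (x 0) - Lmin) with hA
  have hA0 : 0 ≤ A := by positivity
  have hB : ∀ z, HasDerivAt (fun z => A * (Real.exp (-(c / 2) * s) - Real.exp (-(c / 2) * z)))
      (A * (c / 2 * Real.exp (-(c / 2) * z))) z := by
    intro z
    have h2 : HasDerivAt (fun z => Real.exp (-(c / 2) * z))
        (Real.exp (-(c / 2) * z) * (-(c / 2))) z := by
      simpa using ((hasDerivAt_id z).const_mul (-(c / 2))).exp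
    have h3 := (h2.const_sub (Real.exp (-(c / 2) * s))).const_mul A
    rwa [show A * -(Real.exp (-(c / 2) * z) * -(c / 2)) =
      A * (c / 2 * Real.exp (-(c / 2) * z)) by ring] at h3
  have h2 := image_norm_le_of_norm_deriv_right_le_deriv_boundary (f := fun z => x z - x s)
    (f' := fun z => -(∇ L (x z))) (a := s) (b := t)
    ((hx.continuousOn.mono fun z hz => hs.trans hz.1).sub continuousOn_const)
    (fun z hz => (hx.hasDerivWithinAt_Ici (hs.trans hz.1)).sub_const _)
    (by simp) hB (fun z hz => ?_) (right_mem_Icc.2 hst)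
  · refine h2.trans ?_
    have := (Real.exp_pos (-(c / 2) * t)).le
    nlinarith
  · rw [norm_neg]
    have hz0 : 0 ≤ z := hs.trans hz.1
    refine (h.norm_gradient_le (hx.infDist_lt hL h h0 h1 hz0)).trans ?_
    have h3 := hx.sqrt_le hL h h0 h1 hz0
    calc 2 * √ρ * √(L (x z) - Lmin)
        ≤ 2 * √ρ * (Real.exp (-(c / 2) * z) * √(L (x 0) - Lmin)) := by gcongr
      _ = _ := by rw [hA]; field_simp; ring

theorem exists_tendsto (hx : IsGradientFlow L x) (hL : Differentiable ℝ L)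
    (hΓ : IsClosed Γ) (hne : Γ.Nonempty)
    (h : IsPLNeighborhood L Γ Lmin ε κ c ρ) (h0 : infDist (x 0) Γ < ε)
    (h1 : √(L (x 0) - Lmin) / √κ < ε / 2) : ∃ φ ∈ Γ, Tendsto x atTop (𝓝 φ) := by
  have hc := h.c_pos
  have hexp : Tendsto (fun s : ℝ => Real.exp (-(c / 2) * s)) atTop (𝓝 0) :=
    Real.tendsto_exp_atBot.comp (tendsto_id.const_mul_atTop_of_neg (by linarith))
  -- The flow is controlled only at nonnegative times, hence the truncation `max n 0`.
  have hcau : CauchySeq (fun n : ℝ => x (max n 0)) := by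
    have hb : Tendsto (fun s : ℝ => 2 * (4 * √ρ / c * √(L (x 0) - Lmin) *
        Real.exp (-(c / 2) * max s 0))) atTop (𝓝 0) := by
      have h2 : Tendsto (fun s : ℝ => Real.exp (-(c / 2) * max s 0)) atTop (𝓝 0) :=
        hexp.congr' (by filter_upwards [eventually_ge_atTop 0] with s hs; rw [max_eq_left hs])
      simpa using (h2.const_mul (4 * √ρ / c * √(L (x 0) - Lmin))).const_mul 2
    refine cauchySeq_of_le_tendsto_0 _ (fun n m N hn hm => ?_) hb
    have key : ∀ n, N ≤ n → dist (x (max n 0)) (x (max N 0)) ≤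
        4 * √ρ / c * √(L (x 0) - Lmin) * Real.exp (-(c / 2) * max N 0) := fun n hn => by
      rw [dist_eq_norm]
      exact hx.norm_sub_le_exp hL h h0 h1 (le_max_right _ _) (max_le_max_right 0 hn)
    linarith [dist_triangle_right (x (max n 0)) (x (max m 0)) (x (max N 0)), key n hn, key m hm]
  obtain ⟨φ, hφ⟩ := cauchySeq_tendsto_of_complete hcau
  have hφ' : Tendsto x atTop (𝓝 φ) :=
    hφ.congr' (by filter_upwards [eventually_ge_atTop 0] with s hs; rw [max_eq_left hs])
  refine ⟨φ, ?_, hφ'⟩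
  rw [hΓ.mem_iff_infDist_zero hne]
  refine tendsto_nhds_unique (((continuous_infDist_pt Γ).tendsto φ).comp hφ') ?_
  refine squeeze_zero' (Eventually.of_forall fun _ => infDist_nonneg)
    (g := fun t => Real.exp (-(c / 2) * t) * √(L (x 0) - Lmin) / √κ) ?_ ?_
  · filter_upwards [eventually_ge_atTop 0] with t ht
    refine (h.infDist_le (hx.infDist_lt hL h h0 h1 ht)).trans ?_
    gcongr
    exact hx.sqrt_le hL h h0 h1 ht
  · simpa using (hexp.mul_const (√(L (x 0) - Lmin))).div_const √κ

theorem norm_sub_lim_le (hx : IsGradientFlow L x) (hL : Differentiable ℝ L)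
    (h : IsPLNeighborhood L Γ Lmin ε κ c ρ) (h0 : infDist (x 0) Γ < ε)
    (h1 : √(L (x 0) - Lmin) / √κ < ε / 2) {φ : Param d} (hφ : Tendsto x atTop (𝓝 φ))
    {s : ℝ} (hs : 0 ≤ s) : ‖x s - φ‖ ≤ 4 * √ρ / c * √(L (x 0) - Lmin) := by
  rw [norm_sub_rev]
  refine le_of_tendsto ((hφ.sub_const (x s)).norm) ?_
  filter_upwards [eventually_ge_atTop s] with t ht
  refine (hx.norm_sub_le_exp hL h h0 h1 hs ht).trans (mul_le_of_le_one_right ?_ ?_)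
  · have := h.c_pos; positivity
  · rw [Real.exp_le_one_iff]
    nlinarith [h.c_pos]

end IsGradientFlow

/-- As `θnull ∉ Γ`, membership excludes the default value. The flow obtained is the one attached to
the chosen limit, so no global uniqueness is needed to compare it with `flowProj`. -/
theorem exists_isGradientFlow_of_flowProj_mem {L : Param d → ℝ} {Γ : Set (Param d)}
    {θnull θ : Param d} (hnull : θnull ∉ Γ) (h : flowProj L Γ θnull θ ∈ Γ) :
    ∃ x, x 0 = θ ∧ IsGradientFlow L x ∧ Tendsto x atTop (𝓝 (flowProj L Γ θnull θ)) := by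
  by_cases hex : ∃ φ ∈ Γ, FlowConvergesTo L θ φ
  · have hs := hex.choose_spec.2
    have heq : flowProj L Γ θnull θ = hex.choose := dif_pos hex
    rw [heq]
    exact hs
  · have heq : flowProj L Γ θnull θ = θnull := dif_neg hex
    exact absurd (heq ▸ h) hnull

theorem flowProj_mem {L : Param d → ℝ} {Γ : Set (Param d)} {θnull θ φ : Param d}
    (hφ : φ ∈ Γ) (h : FlowConvergesTo L θ φ) : flowProj L Γ θnull θ ∈ Γ := by
  have hex : ∃ φ ∈ Γ, FlowConvergesTo L θ φ := ⟨φ, hφ, h⟩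
  have heq : flowProj L Γ θnull θ = hex.choose := dif_pos hex
  rw [heq]
  exact hex.choose_spec.1

end GradientFlow

/-! ### Local SGD as a noisy Euler scheme for the gradient flow. -/

section Tracking

variable {d : ℕ} {X : Type*}

/-- Discrete Grönwall inequality: the right-hand sides grow by a factor of at most `1 + b ≤ exp b`
per step. -/
theorem le_mul_exp_of_le_add_mul_sum {E : ℕ → ℝ} {A b : ℝ} (hA : 0 ≤ A) (hb : 0 ≤ b) {H : ℕ}
    (h : ∀ t ≤ H, E t ≤ A + b * ∑ j ∈ Finset.range t, E j) {t : ℕ} (ht : t ≤ H) :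
    E t ≤ A * Real.exp (b * H) := by
  have h1 : ∀ t ≤ H, A + b * ∑ j ∈ Finset.range t, E j ≤ A * (1 + b) ^ t := by
    intro t
    induction t with
    | zero => simp
    | succ t ih =>
      intro ht
      have h2 := ih (by omega)
      have h3 := h t (by omega)
      rw [Finset.sum_range_succ, pow_succ]
      nlinarith
  refine ((h t ht).trans (h1 t ht)).trans ?_
  gcongr
  calc (1 + b) ^ t ≤ (Real.exp b) ^ t := by
        gcongr; linarith [Real.add_one_le_exp b]
    _ = Real.exp (b * t) := by rw [← Real.exp_nat_mul, mul_comm]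
    _ ≤ Real.exp (b * H) := by gcongr

theorem norm_batchGrad_le {ℓ : Param d → X → ℝ} {G : ℝ}
    (hG : ∀ θ x, ‖∇ (fun y => ℓ y x) θ‖ ≤ G) (hG0 : 0 ≤ G) {B : ℕ} (θ : Param d)
    (x : Fin B → X) : ‖batchGrad ℓ θ x‖ ≤ G := by
  rw [batchGrad, norm_smul, norm_inv, Real.norm_natCast]
  have h1 : ‖∑ i, ∇ (fun y => ℓ y (x i)) θ‖ ≤ B * G := by
    refine (norm_sum_le_of_le _ fun i _ => hG θ (x i)).trans ?_
    simp
  rcases Nat.eq_zero_or_pos B with rfl | hB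
  · simpa using hG0
  · rw [inv_mul_le_iff₀ (by exact_mod_cast hB)]
    exact h1

/-- The accumulated gradient noise of a worker in its first `t` local steps. -/
def noiseSum (L : Param d → ℝ) (ℓ : Param d → X → ℝ) {B : ℕ} (η : ℝ) (θ : Param d)
    (x : ℕ → Fin B → X) (t : ℕ) : Param d :=
  ∑ j ∈ Finset.range t,
    (batchGrad ℓ (localIter ℓ η θ x j) (x j) - ∇ L (localIter ℓ η θ x j))

theorem localIter_eq (L : Param d → ℝ) (ℓ : Param d → X → ℝ) {B : ℕ} (η : ℝ) (θ : Param d)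
    (x : ℕ → Fin B → X) (t : ℕ) :
    localIter ℓ η θ x t = θ - η • ∑ j ∈ Finset.range t, ∇ L (localIter ℓ η θ x j)
      - η • noiseSum L ℓ η θ x t := by
  induction t with
  | zero => simp [localIter, noiseSum]
  | succ t ih =>
    rw [noiseSum, Finset.sum_range_succ, Finset.sum_range_succ, ← noiseSum, localIter]
    nth_rw 1 [ih]
    module

theorem norm_localIter_sub_le {ℓ : Param d → X → ℝ} {G : ℝ}
    (hG : ∀ θ x, ‖∇ (fun y => ℓ y x) θ‖ ≤ G) (hG0 : 0 ≤ G) {B : ℕ} {η : ℝ} (hη : 0 ≤ η)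
    (θ : Param d) (x : ℕ → Fin B → X) (t : ℕ) :
    ‖localIter ℓ η θ x t - θ‖ ≤ G * (t * η) := by
  induction t with
  | zero => simp [localIter]
  | succ t ih =>
    rw [localIter]
    have h1 : ‖η • batchGrad ℓ (localIter ℓ η θ x t) (x t)‖ ≤ η * G := by
      rw [norm_smul, Real.norm_of_nonneg hη]
      gcongr
      exact norm_batchGrad_le hG hG0 _ _
    calc _ = ‖(localIter ℓ η θ x t - θ) - η • batchGrad ℓ (localIter ℓ η θ x t) (x t)‖ := by
          congr 1; abel
      _ ≤ G * (t * η) + η * G := (norm_sub_le _ _).trans (add_le_add ih h1)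
      _ = _ := by push_cast; ring

/-- The Euler scheme follows a gradient flow with a quadratic error per step. -/
theorem IsGradientFlow.norm_euler_step_le {L : Param d → ℝ} {y : ℝ → Param d}
    (hy : IsGradientFlow L y) {G : ℝ} (hG : ∀ θ, ‖∇ L θ‖ ≤ G) {R ρ : ℝ} (hρ0 : 0 ≤ ρ)
    (hρ : ∀ a ∈ closedBall (0 : Param d) R, ∀ b ∈ closedBall (0 : Param d) R,
      ‖∇ L a - ∇ L b‖ ≤ ρ * ‖a - b‖) {s η : ℝ} (hs : 0 ≤ s) (hη : 0 ≤ η)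
    (hR : ‖y 0‖ + G * (s + η) ≤ R) :
    ‖y (s + η) - y s + η • ∇ L (y s)‖ ≤ ρ * G * η * η := by
  have hG0 : 0 ≤ G := (norm_nonneg _).trans (hG 0)
  have hball : ∀ z ∈ Icc s (s + η), y z ∈ closedBall (0 : Param d) R := by
    intro z hz
    rw [mem_closedBall_zero_iff]
    have h1 := hy.norm_sub_le hG le_rfl (hs.trans hz.1)
    have h2 := norm_le_insert' (y z) (y 0)
    have h3 : G * (z - 0) ≤ G * (s + η) := by gcongr; linarith [hz.2]
    linarith
  have h1 := norm_image_sub_le_of_norm_deriv_right_le_segment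
    (f := fun z => y z + (z - s) • ∇ L (y s)) (f' := fun z => -(∇ L (y z)) + (1 : ℝ) • ∇ L (y s))
    (a := s) (b := s + η) (C := ρ * G * η) ?_ ?_ ?_ (s + η) (right_mem_Icc.2 (by linarith))
  · simp only [add_sub_cancel_left, sub_self, zero_smul, add_zero] at h1
    rwa [sub_add_eq_add_sub]
  · refine ContinuousOn.add (hy.continuousOn.mono fun z hz => hs.trans hz.1) ?_
    exact Continuous.continuousOn (by fun_prop)
  · intro z hz
    refine (hy.hasDerivWithinAt_Ici (hs.trans hz.1)).add ?_
    exact (((hasDerivAt_id z).sub_const s).smul_const _).hasDerivWithinAt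
  · intro z hz
    rw [one_smul, neg_add_eq_sub, norm_sub_rev]
    refine (hρ _ (hball z (Ico_subset_Icc_self hz)) _ (hball s ⟨le_rfl, by linarith⟩)).trans ?_
    rw [mul_assoc]
    gcongr
    refine (hy.norm_sub_le hG hs hz.1).trans ?_
    gcongr
    linarith [hz.2]

/-- A worker follows the gradient flow up to the discretization error and the gradient noise. -/
theorem norm_localIter_sub_flow_le {L : Param d → ℝ} {ℓ : Param d → X → ℝ} {G : ℝ}
    (hG : ∀ θ x, ‖∇ (fun y => ℓ y x) θ‖ ≤ G) (hGL : ∀ θ, ‖∇ L θ‖ ≤ G) {R ρ : ℝ} (hρ0 : 0 ≤ ρ)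
    (hρ : ∀ a ∈ closedBall (0 : Param d) R, ∀ b ∈ closedBall (0 : Param d) R,
      ‖∇ L a - ∇ L b‖ ≤ ρ * ‖a - b‖) {B H : ℕ} {η N : ℝ} (hη : 0 ≤ η) {y : ℝ → Param d}
    (hy : IsGradientFlow L y) {θ : Param d} {x : ℕ → Fin B → X}
    (hθR : ‖θ‖ + G * (H * η) ≤ R) (hyR : ‖y 0‖ + G * (H * η) ≤ R)
    (hN : ∀ t ≤ H, η * ‖noiseSum L ℓ η θ x t‖ ≤ N) {t : ℕ} (ht : t ≤ H) :
    ‖localIter ℓ η θ x t - y (t * η)‖ ≤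
      (‖θ - y 0‖ + ρ * G * η * (H * η) + N) * Real.exp (ρ * (H * η)) := by
  have hG0 : 0 ≤ G := (norm_nonneg _).trans (hGL 0)
  have hN0 : 0 ≤ N := by simpa [noiseSum] using hN 0 (Nat.zero_le _)
  have hmono : ∀ t ≤ H, G * (t * η) ≤ G * (H * η) := fun t ht => by gcongr
  have hθball : ∀ t ≤ H, localIter ℓ η θ x t ∈ closedBall (0 : Param d) R := by
    intro t ht
    rw [mem_closedBall_zero_iff]
    linarith [norm_localIter_sub_le hG hG0 hη θ x t, hmono t ht,
      norm_le_insert' (localIter ℓ η θ x t) θ]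
  have hyball : ∀ t : ℕ, t ≤ H → y (t * η) ∈ closedBall (0 : Param d) R := by
    intro t ht
    rw [mem_closedBall_zero_iff]
    have h1 := hy.norm_sub_le hGL le_rfl (t := t * η) (by positivity)
    rw [sub_zero] at h1
    linarith [hmono t ht, norm_le_insert' (y (t * η)) (y 0)]
  have hflow : ∀ t : ℕ, t ≤ H →
      ‖y (t * η) - y 0 + η • ∑ j ∈ Finset.range t, ∇ L (y (j * η))‖ ≤ t * (ρ * G * η * η) := by
    intro t
    induction t with
    | zero => simp
    | succ t ih =>
      intro ht
      have h1 := hy.norm_euler_step_le hGL hρ0 hρ (s := t * η) (by positivity) hη (by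
        have := hmono (t + 1) ht
        push_cast at this
        linarith)
      have h2 := norm_add_le_of_le (ih (by omega)) h1
      rw [Finset.sum_range_succ]
      push_cast
      rw [add_mul, one_mul]
      refine (le_of_eq ?_).trans (h2.trans_eq (by ring))
      congr 1
      module
  have hrec : ∀ t ≤ H, ‖localIter ℓ η θ x t - y (t * η)‖ ≤
      (‖θ - y 0‖ + ρ * G * η * (H * η) + N) +
        ρ * η * ∑ j ∈ Finset.range t, ‖localIter ℓ η θ x j - y (j * η)‖ := by
    intro t ht
    -- The four terms are the initial error, the difference of gradients (fed to Grönwall), the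
    -- discretization error and the noise.
    have heq : localIter ℓ η θ x t - y (t * η) = (θ - y 0)
        - η • ∑ j ∈ Finset.range t, (∇ L (localIter ℓ η θ x j) - ∇ L (y (j * η)))
        - (y (t * η) - y 0 + η • ∑ j ∈ Finset.range t, ∇ L (y (j * η)))
        - η • noiseSum L ℓ η θ x t := by
      nth_rw 1 [localIter_eq L]
      rw [Finset.sum_sub_distrib]
      module
    have h1 : ‖η • ∑ j ∈ Finset.range t, (∇ L (localIter ℓ η θ x j) - ∇ L (y (j * η)))‖ ≤
        ρ * η * ∑ j ∈ Finset.range t, ‖localIter ℓ η θ x j - y (j * η)‖ := by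
      rw [norm_smul, Real.norm_of_nonneg hη, mul_comm ρ η, mul_assoc, Finset.mul_sum]
      gcongr
      refine norm_sum_le_of_le _ fun j hj => ?_
      have hj' : j ≤ H := (Finset.mem_range.1 hj).le.trans ht
      exact hρ _ (hθball j hj') _ (hyball j hj')
    have h2 : (t : ℝ) * (ρ * G * η * η) ≤ ρ * G * η * (H * η) := by
      have : (t : ℝ) * (ρ * G * η * η) ≤ H * (ρ * G * η * η) := by gcongr
      linarith
    have h3 : ‖η • noiseSum L ℓ η θ x t‖ ≤ N := by
      rw [norm_smul, Real.norm_of_nonneg hη]; exact hN t ht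
    rw [heq]
    have h4 := (hflow t ht).trans h2
    generalize η • noiseSum L ℓ η θ x t = a at h3 ⊢
    generalize y (t * η) - y 0 + η • ∑ j ∈ Finset.range t, ∇ L (y (j * η)) = b at h4 ⊢
    generalize η • ∑ j ∈ Finset.range t, (∇ L (localIter ℓ η θ x j) - ∇ L (y (j * η))) = c at h1 ⊢
    linarith [norm_sub_le (θ - y 0 - c - b) a, norm_sub_le (θ - y 0 - c) b, norm_sub_le (θ - y 0) c]
  have := le_mul_exp_of_le_add_mul_sum (by positivity) (by positivity) hrec ht
  rwa [show ρ * η * (H : ℝ) = ρ * (H * η) by ring] at this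

theorem norm_average_sub_le {K : ℕ} (hK : 0 < K) {f : Fin K → Param d} {y : Param d} {b : ℝ}
    (h : ∀ k, ‖f k - y‖ ≤ b) : ‖(K : ℝ)⁻¹ • ∑ k, f k - y‖ ≤ b := by
  have hK' : (0 : ℝ) < K := by exact_mod_cast hK
  have h1 : (K : ℝ)⁻¹ • ∑ k, f k - y = (K : ℝ)⁻¹ • ∑ k, (f k - y) := by
    rw [Finset.sum_sub_distrib, smul_sub]
    simp only [Finset.sum_const, Finset.card_univ, Fintype.card_fin]
    rw [← Nat.cast_smul_eq_nsmul ℝ, inv_smul_smul₀ hK'.ne']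
  rw [h1, norm_smul, norm_inv, Real.norm_natCast, inv_mul_le_iff₀ hK']
  refine (norm_sum_le_of_le _ fun k _ => h k).trans ?_
  simp

end Tracking

open MeasureTheory ProbabilityTheory

/-! ### Measurability and concentration of the gradient noise. -/

section Probability

variable {d : ℕ} {X : Type*} [MeasurableSpace X]

theorem gradient_apply (f : Param d → ℝ) (θ : Param d) (j : Fin d) :
    (∇ f θ) j = fderiv ℝ f θ (EuclideanSpace.single j 1) := by
  rw [← inner_gradient_left, EuclideanSpace.inner_single_right]
  simp

/-- The loss is jointly measurable, being continuous in `θ` and measurable in the sample; each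
partial derivative is a pointwise limit of its difference quotients. -/
theorem measurable_gradient_uncurry {ℓ : Param d → X → ℝ} (hm : ∀ θ, Measurable (ℓ θ))
    (hd : ∀ x, Differentiable ℝ (fun θ => ℓ θ x)) :
    Measurable (fun p : Param d × X => ∇ (fun y => ℓ y p.2) p.1) := by
  have hu : Measurable (Function.uncurry ℓ) :=
    measurable_uncurry_of_continuous_of_measurable (fun x => (hd x).continuous) hm
  have hcoord : Measurable (fun (p : Param d × X) (j : Fin d) => (∇ (fun y => ℓ y p.2) p.1) j) := by
    refine measurable_pi_lambda _ fun j => ?_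
    simp only [gradient_apply]
    set v : Param d := EuclideanSpace.single j 1
    refine measurable_of_tendsto_metrizable
      (f := fun (n : ℕ) (p : Param d × X) => (n : ℝ) •
        (ℓ (p.1 + (n : ℝ)⁻¹ • v) p.2 - ℓ p.1 p.2)) (fun n => ?_) ?_
    · have h1 : Measurable (fun p : Param d × X => (p.1 + (n : ℝ)⁻¹ • v, p.2)) := by
        fun_prop
      exact ((hu.comp h1).sub hu).const_smul (n : ℝ)
    · rw [tendsto_pi_nhds]
      intro p
      refine (hd p.2 p.1).hasFDerivAt.lim (l := atTop) (c := fun n : ℕ => (n : ℝ)) v ?_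
      simpa using tendsto_natCast_atTop_atTop (R := ℝ)
  exact (MeasurableEquiv.toLp 2 (Fin d → ℝ)).measurable.comp hcoord

theorem hasFDerivAt_expectedLoss {D : Measure X} [IsProbabilityMeasure D] {ℓ : Param d → X → ℝ}
    (hm : ∀ θ, Measurable (ℓ θ)) (hi : ∀ θ, Integrable (ℓ θ) D)
    (hd : ∀ x, Differentiable ℝ (fun θ => ℓ θ x)) {G : ℝ}
    (hG : ∀ θ x, ‖∇ (fun y => ℓ y x) θ‖ ≤ G) (θ : Param d) :
    Integrable (fun x => fderiv ℝ (fun y => ℓ y x) θ) D ∧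
    HasFDerivAt (expectedLoss ℓ D) (∫ x, fderiv ℝ (fun y => ℓ y x) θ ∂D) θ := by
  have hF : AEStronglyMeasurable (fun x => fderiv ℝ (fun y => ℓ y x) θ) D := by
    have h1 : Measurable (fun x => ∇ (fun y => ℓ y x) θ) :=
      (measurable_gradient_uncurry hm hd).comp (measurable_const.prodMk measurable_id)
    have h2 := (InnerProductSpace.toDual ℝ (Param d)).continuous.comp_aestronglyMeasurable
      h1.aestronglyMeasurable (μ := D)
    simpa only [toDual_gradient] using h2
  have hb : ∀ θ x, ‖fderiv ℝ (fun y => ℓ y x) θ‖ ≤ G := by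
    intro θ x
    rw [← toDual_gradient, LinearIsometryEquiv.norm_map]
    exact hG θ x
  refine ⟨(integrable_const G).mono' hF (ae_of_all _ (hb θ)), ?_⟩
  exact hasFDerivAt_integral_of_dominated_of_fderiv_le (F' := fun θ x => fderiv ℝ (fun y => ℓ y x) θ)
    (bound := fun _ => G) univ_mem
    (Eventually.of_forall fun θ => (hm θ).aestronglyMeasurable) (hi θ) hF
    (ae_of_all _ fun x θ _ => hb θ x) (integrable_const G)
    (ae_of_all _ fun x θ _ => (hd x θ).hasFDerivAt)

theorem gradient_expectedLoss_apply {D : Measure X} [IsProbabilityMeasure D] {ℓ : Param d → X → ℝ}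
    (hm : ∀ θ, Measurable (ℓ θ)) (hi : ∀ θ, Integrable (ℓ θ) D)
    (hd : ∀ x, Differentiable ℝ (fun θ => ℓ θ x)) {G : ℝ}
    (hG : ∀ θ x, ‖∇ (fun y => ℓ y x) θ‖ ≤ G) (θ : Param d) (j : Fin d) :
    (∇ (expectedLoss ℓ D) θ) j = ∫ x, (∇ (fun y => ℓ y x) θ) j ∂D := by
  obtain ⟨h1, h2⟩ := hasFDerivAt_expectedLoss (D := D) hm hi hd hG θ
  simp only [gradient_apply]
  rw [h2.fderiv, ContinuousLinearMap.integral_apply h1]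

theorem norm_gradient_expectedLoss_le {D : Measure X} [IsProbabilityMeasure D]
    {ℓ : Param d → X → ℝ}
    (hm : ∀ θ, Measurable (ℓ θ)) (hi : ∀ θ, Integrable (ℓ θ) D)
    (hd : ∀ x, Differentiable ℝ (fun θ => ℓ θ x)) {G : ℝ}
    (hG : ∀ θ x, ‖∇ (fun y => ℓ y x) θ‖ ≤ G) (θ : Param d) :
    ‖∇ (expectedLoss ℓ D) θ‖ ≤ G := by
  obtain ⟨h1, h2⟩ := hasFDerivAt_expectedLoss (D := D) hm hi hd hG θ
  rw [← (InnerProductSpace.toDual ℝ (Param d)).norm_map, toDual_gradient, h2.fderiv]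
  have := norm_integral_le_of_norm_le_const (μ := D) (C := G)
    (f := fun x => fderiv ℝ (fun y => ℓ y x) θ) (ae_of_all _ fun x => by
      rw [← toDual_gradient, LinearIsometryEquiv.norm_map]
      exact hG θ x)
  simpa using this

section Measurability

variable {Ω : Type*} {mΩ : MeasurableSpace Ω} {ℓ : Param d → X → ℝ}

theorem measurable_batchGrad
    (hgrad : Measurable (fun p : Param d × X => ∇ (fun y => ℓ y p.2) p.1)) {B : ℕ}
    {θ : Ω → Param d} (hθ : Measurable θ) {x : Ω → Fin B → X}
    (hx : ∀ i, Measurable (fun w => x w i)) :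
    Measurable (fun w => batchGrad ℓ (θ w) (x w)) := by
  unfold batchGrad
  have h : Measurable (fun w => ∑ i, ∇ (fun y => ℓ y (x w i)) (θ w)) :=
    Finset.measurable_sum _ fun i _ => hgrad.comp (hθ.prodMk (hx i))
  exact h.const_smul (B : ℝ)⁻¹

/-- The σ-algebra on `Ω` is arbitrary and only the batches before step `n` need be measurable, so
that the lemma applies to `pastSigma` and yields adaptedness. -/
theorem measurable_localIter
    (hgrad : Measurable (fun p : Param d × X => ∇ (fun y => ℓ y p.2) p.1)) {B : ℕ} (η : ℝ)
    {θ : Ω → Param d} (hθ : Measurable θ) {x : Ω → ℕ → Fin B → X} (n : ℕ)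
    (hx : ∀ t < n, ∀ i, Measurable (fun w => x w t i)) :
    ∀ t ≤ n, Measurable (fun w => localIter ℓ η (θ w) (x w) t) := by
  intro t
  induction t with
  | zero => exact fun _ => hθ
  | succ t ih =>
    intro ht
    exact (ih (by omega)).sub
      ((measurable_batchGrad hgrad (ih (by omega)) (hx t (by omega))).const_smul η)

theorem measurable_globalIter
    (hgrad : Measurable (fun p : Param d × X => ∇ (fun y => ℓ y p.2) p.1)) {K B : ℕ} (η : ℝ)
    (H : ℕ) (θ₀ : Param d) {x : Ω → ℕ → Fin K → ℕ → Fin B → X} (n : ℕ)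
    (hx : ∀ s < n, ∀ k t i, Measurable (fun w => x w s k t i)) :
    ∀ s ≤ n, Measurable (fun w => globalIter ℓ η H θ₀ (x w) s) := by
  intro s
  induction s with
  | zero => exact fun _ => measurable_const
  | succ s ih =>
    intro hs
    have h : Measurable (fun w => ∑ k, localIter ℓ η (globalIter ℓ η H θ₀ (x w) s) (x w s k) H) :=
      Finset.measurable_sum _ fun k _ => measurable_localIter hgrad η (ih (by omega)) H
        (fun t _ i => hx s (by omega) k t i) H le_rfl
    exact h.const_smul (K : ℝ)⁻¹

theorem measurable_noiseSum {L : Param d → ℝ} (hL : Measurable (∇ L))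
    (hgrad : Measurable (fun p : Param d × X => ∇ (fun y => ℓ y p.2) p.1)) {B : ℕ} (η : ℝ)
    {θ : Ω → Param d} (hθ : Measurable θ) {x : Ω → ℕ → Fin B → X} (t : ℕ)
    (hx : ∀ s < t, ∀ i, Measurable (fun w => x w s i)) :
    Measurable (fun w => noiseSum L ℓ η (θ w) (x w) t) := by
  refine Finset.measurable_sum _ fun j hj => ?_
  have hj' := Finset.mem_range.1 hj
  have h1 := measurable_localIter hgrad η hθ t hx j hj'.le
  exact (measurable_batchGrad hgrad h1 (hx j hj')).sub (hL.comp h1)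

end Measurability

/-- A bounded centred increment that is independent of the past multiplies an exponential moment
by at most the factor of Hoeffding's lemma. -/
theorem lintegral_exp_add_le {Ω E F : Type*} [MeasurableSpace Ω] [MeasurableSpace E]
    [MeasurableSpace F] {P : Measure Ω} [IsProbabilityMeasure P] {U : Ω → E} {Z : Ω → F}
    (hU : Measurable U) (hZ : Measurable Z) (hind : IndepFun U Z P) {ψ : E → ℝ}
    (hψ : Measurable ψ) {f : E × F → ℝ} (hf : Measurable f) {b : ℝ} (hb : ∀ p, |f p| ≤ b)
    (hmean : ∀ u, ∫ w, f (u, Z w) ∂P = 0) (r : ℝ) :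
    ∫⁻ w, ENNReal.ofReal (Real.exp (r * (ψ (U w) + f (U w, Z w)))) ∂P ≤
      ENNReal.ofReal (Real.exp (b ^ 2 * r ^ 2 / 2)) *
        ∫⁻ w, ENNReal.ofReal (Real.exp (r * ψ (U w))) ∂P := by
  have hmap := hind.map_prod_eq_prod_map_map hU.aemeasurable hZ.aemeasurable
  have hmeas : Measurable (fun p : E × F => ENNReal.ofReal (Real.exp (r * (ψ p.1 + f p)))) := by
    fun_prop
  have hprob : IsProbabilityMeasure (P.map U) := Measure.isProbabilityMeasure_map hU.aemeasurable
  have hprob' : IsProbabilityMeasure (P.map Z) := Measure.isProbabilityMeasure_map hZ.aemeasurable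
  -- With the past frozen at `u`, the increment is centred and lies in `[-b, b]`; independence then
  -- allows integrating over `u` by Fubini–Tonelli.
  have hstep : ∀ u, ∫⁻ z, ENNReal.ofReal (Real.exp (r * (ψ u + f (u, z)))) ∂(P.map Z) ≤
      ENNReal.ofReal (Real.exp (b ^ 2 * r ^ 2 / 2)) * ENNReal.ofReal (Real.exp (r * ψ u)) := by
    intro u
    have hfu : Measurable (fun w => f (u, Z w)) := hf.comp (measurable_const.prodMk hZ)
    have hsub := hasSubgaussianMGF_of_mem_Icc_of_integral_eq_zero (μ := P) (a := -b) (b := b)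
      hfu.aemeasurable (ae_of_all _ fun w => abs_le.1 (hb (u, Z w))) (hmean u)
    have hb0 : 0 ≤ b := (abs_nonneg _).trans (hb (u, Z (Classical.choice P.nonempty_of_neZero)))
    have h1 : ∫ w, Real.exp (r * f (u, Z w)) ∂P ≤ Real.exp (b ^ 2 * r ^ 2 / 2) := by
      refine (hsub.mgf_le r).trans_eq ?_
      congr 3
      simp only [NNReal.coe_pow, NNReal.coe_div, coe_nnnorm, NNReal.coe_ofNat, Real.norm_eq_abs]
      rw [sub_neg_eq_add, ← two_mul, abs_of_nonneg (by positivity)]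
      ring
    rw [lintegral_map (by fun_prop) hZ]
    calc ∫⁻ w, ENNReal.ofReal (Real.exp (r * (ψ u + f (u, Z w)))) ∂P
        = ∫⁻ w, ENNReal.ofReal (Real.exp (r * ψ u)) *
            ENNReal.ofReal (Real.exp (r * f (u, Z w))) ∂P := by
          refine lintegral_congr fun w => ?_
          rw [← ENNReal.ofReal_mul (Real.exp_pos _).le, ← Real.exp_add, mul_add]
      _ = ENNReal.ofReal (Real.exp (r * ψ u)) *
            ∫⁻ w, ENNReal.ofReal (Real.exp (r * f (u, Z w))) ∂P :=
          lintegral_const_mul _ (by fun_prop)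
      _ ≤ ENNReal.ofReal (Real.exp (r * ψ u)) * ENNReal.ofReal (Real.exp (b ^ 2 * r ^ 2 / 2)) := by
          gcongr
          rw [← ofReal_integral_eq_lintegral_ofReal (hsub.integrable_exp_mul r)
            (ae_of_all _ fun w => (Real.exp_pos _).le)]
          exact ENNReal.ofReal_le_ofReal h1
      _ = _ := mul_comm _ _
  calc ∫⁻ w, ENNReal.ofReal (Real.exp (r * (ψ (U w) + f (U w, Z w)))) ∂P
      = ∫⁻ p, ENNReal.ofReal (Real.exp (r * (ψ p.1 + f p))) ∂(P.map fun w => (U w, Z w)) := by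
        rw [lintegral_map hmeas (hU.prodMk hZ)]
    _ = ∫⁻ u, ∫⁻ z, ENNReal.ofReal (Real.exp (r * (ψ u + f (u, z)))) ∂(P.map Z) ∂(P.map U) := by
        rw [hmap, lintegral_prod _ hmeas.aemeasurable]
    _ ≤ ∫⁻ u, ENNReal.ofReal (Real.exp (b ^ 2 * r ^ 2 / 2)) *
          ENNReal.ofReal (Real.exp (r * ψ u)) ∂(P.map U) := lintegral_mono hstep
    _ = _ := by
        rw [lintegral_const_mul _ (by fun_prop), lintegral_map (by fun_prop) hU]

theorem integral_batchGrad_sub_apply_eq_zero {D : Measure X} [IsProbabilityMeasure D]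
    {ℓ : Param d → X → ℝ} (hm : ∀ θ, Measurable (ℓ θ)) (hi : ∀ θ, Integrable (ℓ θ) D)
    (hd : ∀ x, Differentiable ℝ (fun θ => ℓ θ x)) {G : ℝ}
    (hG : ∀ θ x, ‖∇ (fun y => ℓ y x) θ‖ ≤ G) {Ω : Type*} [MeasurableSpace Ω] {P : Measure Ω}
    [IsProbabilityMeasure P] {B : ℕ} (hB : 0 < B) {z : Ω → Fin B → X}
    (hz : ∀ i, Measurable (fun w => z w i)) (hlaw : ∀ i, P.map (fun w => z w i) = D)
    (θ : Param d) (j : Fin d) :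
    ∫ w, (batchGrad ℓ θ (z w) - ∇ (expectedLoss ℓ D) θ) j ∂P = 0 := by
  have hgm : Measurable (fun x => (∇ (fun y => ℓ y x) θ) j) := by
    have h1 : Measurable (fun x => ∇ (fun y => ℓ y x) θ) :=
      (measurable_gradient_uncurry hm hd).comp (measurable_const.prodMk measurable_id)
    exact (EuclideanSpace.proj (𝕜 := ℝ) j).continuous.measurable.comp h1
  have hint : ∀ i, Integrable (fun w => (∇ (fun y => ℓ y (z w i)) θ) j) P := fun i =>
    (integrable_const G).mono' (hgm.comp (hz i)).aestronglyMeasurable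
      (ae_of_all _ fun w => (PiLp.norm_apply_le _ j).trans (hG θ _))
  have hval : ∀ i, ∫ w, (∇ (fun y => ℓ y (z w i)) θ) j ∂P = (∇ (expectedLoss ℓ D) θ) j := by
    intro i
    rw [gradient_expectedLoss_apply hm hi hd hG, ← hlaw i,
      integral_map (hz i).aemeasurable hgm.aestronglyMeasurable]
  have hB' : (B : ℝ) ≠ 0 := by exact_mod_cast hB.ne'
  have heq : ∀ w, (batchGrad ℓ θ (z w) - ∇ (expectedLoss ℓ D) θ) j =
      (B : ℝ)⁻¹ * ∑ i, (∇ (fun y => ℓ y (z w i)) θ) j - (∇ (expectedLoss ℓ D) θ) j := by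
    intro w
    simp [batchGrad]
  simp only [heq]
  rw [integral_sub ((integrable_finsetSum _ fun i _ => hint i).const_mul _) (integrable_const _),
    integral_const_mul, integral_finsetSum _ fun i _ => hint i]
  simp only [hval, Finset.sum_const, Finset.card_univ, Fintype.card_fin, nsmul_eq_mul,
    integral_const, probReal_univ, one_smul]
  rw [inv_mul_cancel_left₀ hB', sub_self]

section Noise

variable {D : Measure X} [IsProbabilityMeasure D] {ℓ : Param d → X → ℝ}
    {Ω : Type*} [mΩ : MeasurableSpace Ω] {P : Measure Ω} {K B : ℕ}
    {ξ : ℕ × Fin K × ℕ × Fin B → Ω → X}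

/-- The `σ`-algebra of the samples used before local step `t` of round `s`. -/
abbrev pastSigma (ξ : ℕ × Fin K × ℕ × Fin B → Ω → X) (s t : ℕ) : MeasurableSpace Ω :=
  ⨆ i ∈ {i : ℕ × Fin K × ℕ × Fin B | i.1 < s ∨ (i.1 = s ∧ i.2.2.1 < t)},
    MeasurableSpace.comap (ξ i) inferInstance

/-- The past and the current batch are generated by samples with disjoint index sets. The past
includes earlier steps of all workers, not only of worker `k`. -/
theorem indepFun_past_present (hξ : ∀ i, Measurable (ξ i)) (hind : iIndepFun ξ P)
    (s : ℕ) (k : Fin K) (t : ℕ) {E : Type*} [MeasurableSpace E] {U : Ω → E}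
    (hU : Measurable[pastSigma ξ s t] U) :
    IndepFun U (fun w i => ξ (s, k, t, i) w) P := by
  set S := {i : ℕ × Fin K × ℕ × Fin B | i.1 < s ∨ (i.1 = s ∧ i.2.2.1 < t)}
  set T := {i : ℕ × Fin K × ℕ × Fin B | i.1 = s ∧ i.2.2.1 = t}
  have hST : Disjoint S T := by
    rw [Set.disjoint_left]
    rintro i (h | h) ⟨h1, h2⟩ <;> omega
  have h := indep_iSup_of_disjoint (fun i => (hξ i).comap_le)
    ((iIndepFun_iff_iIndep _ _ _).1 hind) hST
  rw [IndepFun_iff_Indep]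
  refine indep_of_indep_of_le_left (indep_of_indep_of_le_right h ?_) hU.comap_le
  refine Measurable.comap_le ?_
  refine @measurable_pi_lambda _ _ _ (_) _ _ fun i => ?_
  refine Measurable.mono (comap_measurable (ξ (s, k, t, i))) ?_ le_rfl
  exact le_iSup₂_of_le (s, k, t, i) (show _ ∧ _ from ⟨rfl, rfl⟩) le_rfl

variable [IsProbabilityMeasure P]

/-- Azuma–Hoeffding by induction on `t`: each new increment is centred given the past and bounded by
`2 * G`. Lower integrals avoid integrability questions about the accumulated sum. -/
theorem lintegral_exp_noiseSum_le (hm : ∀ θ, Measurable (ℓ θ)) (hi : ∀ θ, Integrable (ℓ θ) D)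
    (hd : ∀ x, Differentiable ℝ (fun θ => ℓ θ x)) {G : ℝ}
    (hG : ∀ θ x, ‖∇ (fun y => ℓ y x) θ‖ ≤ G) (hL : Measurable (∇ (expectedLoss ℓ D)))
    (hB : 0 < B) (hξ : ∀ i, Measurable (ξ i)) (hlaw : ∀ i, P.map (ξ i) = D)
    (hind : iIndepFun ξ P) (η : ℝ) (H : ℕ) (θ₀ : Param d) (s : ℕ) (k : Fin K) (j : Fin d)
    (r : ℝ) (t : ℕ) :
    ∫⁻ w, ENNReal.ofReal (Real.exp (r * (noiseSum (expectedLoss ℓ D) ℓ η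
      (globalIter ℓ η H θ₀ (fun s k t i => ξ (s, k, t, i) w) s)
      (fun t i => ξ (s, k, t, i) w) t) j)) ∂P ≤
    ENNReal.ofReal (Real.exp (t * ((2 * G) ^ 2 * r ^ 2 / 2))) := by
  have hgrad := measurable_gradient_uncurry hm hd
  have hGL := norm_gradient_expectedLoss_le (D := D) hm hi hd hG
  have hG0 : 0 ≤ G := (norm_nonneg _).trans (hGL 0)
  induction t with
  | zero => simp [noiseSum]
  | succ t ih =>
    have hZ : Measurable (fun w i => ξ (s, k, t, i) w) := measurable_pi_lambda _ fun i => hξ _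
    have hle : pastSigma ξ s t ≤ mΩ := iSup₂_le fun i _ => (hξ i).comap_le
    have hpast : ∀ i : ℕ × Fin K × ℕ × Fin B, (i.1 < s ∨ (i.1 = s ∧ i.2.2.1 < t)) →
        Measurable[pastSigma ξ s t] (ξ i) := fun i hi =>
      Measurable.mono (comap_measurable (ξ i)) (le_iSup₂_of_le i hi le_rfl) le_rfl
    have hθ : Measurable[pastSigma ξ s t]
        (fun w => globalIter ℓ η H θ₀ (fun s k t i => ξ (s, k, t, i) w) s) :=
      measurable_globalIter (mΩ := pastSigma ξ s t) hgrad η H θ₀ s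
        (fun s' hs' k t i => hpast _ (Or.inl hs')) s le_rfl
    have hloc : Measurable[pastSigma ξ s t] (fun w => localIter ℓ η
        (globalIter ℓ η H θ₀ (fun s k t i => ξ (s, k, t, i) w) s)
        (fun t i => ξ (s, k, t, i) w) t) :=
      measurable_localIter (mΩ := pastSigma ξ s t) hgrad η hθ t
        (fun t' ht' i => hpast _ (Or.inr ⟨rfl, ht'⟩)) t le_rfl
    have hns : Measurable[pastSigma ξ s t] (fun w => (noiseSum (expectedLoss ℓ D) ℓ η
        (globalIter ℓ η H θ₀ (fun s k t i => ξ (s, k, t, i) w) s)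
        (fun t i => ξ (s, k, t, i) w) t) j) :=
      (EuclideanSpace.proj (𝕜 := ℝ) j).continuous.measurable.comp
        (measurable_noiseSum (mΩ := pastSigma ξ s t) hL hgrad η hθ t
          (fun t' ht' i => hpast _ (Or.inr ⟨rfl, ht'⟩)))
    -- The relevant past is the pair of current iterate, which determines the law of the increment,
    -- and accumulated noise, which enters the exponent.
    have hU := hloc.prodMk hns
    have hf : Measurable (fun p : (Param d × ℝ) × (Fin B → X) =>
        (batchGrad ℓ p.1.1 p.2 - ∇ (expectedLoss ℓ D) p.1.1) j) := by
      have h1 : Measurable (fun p : (Param d × ℝ) × (Fin B → X) => p.1.1) := by fun_prop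
      exact (EuclideanSpace.proj (𝕜 := ℝ) j).continuous.measurable.comp
        ((measurable_batchGrad hgrad h1 (x := fun p => p.2) (fun i => by fun_prop)).sub
          (hL.comp h1))
    have key := lintegral_exp_add_le (hU.mono hle le_rfl) hZ
      (indepFun_past_present hξ hind s k t hU) (ψ := Prod.snd) measurable_snd hf (b := 2 * G)
      (fun p => ?_) (fun u => ?_) r
    · have heq : ∀ w, (noiseSum (expectedLoss ℓ D) ℓ η
          (globalIter ℓ η H θ₀ (fun s k t i => ξ (s, k, t, i) w) s)
          (fun t i => ξ (s, k, t, i) w) (t + 1)) j =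
          (noiseSum (expectedLoss ℓ D) ℓ η
          (globalIter ℓ η H θ₀ (fun s k t i => ξ (s, k, t, i) w) s)
          (fun t i => ξ (s, k, t, i) w) t) j +
          (batchGrad ℓ (localIter ℓ η
            (globalIter ℓ η H θ₀ (fun s k t i => ξ (s, k, t, i) w) s)
            (fun t i => ξ (s, k, t, i) w) t) (fun i => ξ (s, k, t, i) w) -
            ∇ (expectedLoss ℓ D) (localIter ℓ η
            (globalIter ℓ η H θ₀ (fun s k t i => ξ (s, k, t, i) w) s)
            (fun t i => ξ (s, k, t, i) w) t)) j := by
        intro w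
        rw [noiseSum, Finset.sum_range_succ, PiLp.add_apply]
        rfl
      simp only [heq]
      refine key.trans ((mul_le_mul_right ih _).trans_eq ?_)
      rw [← ENNReal.ofReal_mul (Real.exp_pos _).le, ← Real.exp_add]
      congr 2
      push_cast
      ring
    · have h1 := PiLp.norm_apply_le (batchGrad ℓ p.1.1 p.2 - ∇ (expectedLoss ℓ D) p.1.1) j
      rw [Real.norm_eq_abs] at h1
      linarith [norm_batchGrad_le hG hG0 p.1.1 p.2, hGL p.1.1,
        norm_sub_le (batchGrad ℓ p.1.1 p.2) (∇ (expectedLoss ℓ D) p.1.1)]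
    · exact integral_batchGrad_sub_apply_eq_zero hm hi hd hG hB (fun i => hξ _)
        (fun i => hlaw _) u.1 j

/-- Chernoff's bound for both tails of a variable with a sub-Gaussian exponential moment. -/
theorem measureReal_abs_ge_le {Y : Ω → ℝ} (hY : Measurable Y) {v a : ℝ} (hv : 0 < v) (ha : 0 ≤ a)
    (h : ∀ r : ℝ, ∫⁻ w, ENNReal.ofReal (Real.exp (r * Y w)) ∂P ≤
      ENNReal.ofReal (Real.exp (v * r ^ 2 / 2))) :
    P.real {w | a < |Y w|} ≤ 2 * Real.exp (-a ^ 2 / (2 * v)) := by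
  -- The optimal exponents are `r = ± a / v`. Writing the event as `a ^ 2 / v ≤ r * Y w` also covers
  -- `a = 0`.
  have tail : ∀ r : ℝ, P.real {w | a ^ 2 / v ≤ r * Y w} ≤
      Real.exp (-(a ^ 2 / v)) * Real.exp (v * r ^ 2 / 2) := by
    intro r
    have hmeas : Measurable (fun w => ENNReal.ofReal (Real.exp (r * Y w))) := by fun_prop
    have h1 := (mul_meas_ge_le_lintegral (μ := P) hmeas
      (ENNReal.ofReal (Real.exp (a ^ 2 / v)))).trans (h r)
    have h2 : {w | a ^ 2 / v ≤ r * Y w} ⊆ {w | ENNReal.ofReal (Real.exp (a ^ 2 / v)) ≤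
        ENNReal.ofReal (Real.exp (r * Y w))} := fun w hw =>
      ENNReal.ofReal_le_ofReal (Real.exp_le_exp.2 hw)
    have h3 := (mul_le_mul_right (measure_mono h2) _).trans h1
    rw [← ofReal_measureReal, ← ENNReal.ofReal_mul (Real.exp_pos _).le,
      ENNReal.ofReal_le_ofReal_iff (Real.exp_pos _).le] at h3
    rw [Real.exp_neg, ← div_eq_inv_mul, le_div_iff₀ (Real.exp_pos _), mul_comm]
    exact h3
  have hsub : {w | a < |Y w|} ⊆ {w | a ^ 2 / v ≤ a / v * Y w} ∪ {w | a ^ 2 / v ≤ -(a / v) * Y w} := by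
    intro w hw
    have hav : 0 ≤ a / v := by positivity
    have he : a ^ 2 / v = a / v * a := by ring
    rcases lt_abs.1 (show a < |Y w| from hw) with h1 | h1
    · left
      show a ^ 2 / v ≤ a / v * Y w
      rw [he]; gcongr
    · right
      show a ^ 2 / v ≤ -(a / v) * Y w
      rw [he, neg_mul, ← mul_neg]; gcongr
  have hexp : ∀ r, r ^ 2 = (a / v) ^ 2 → Real.exp (-(a ^ 2 / v)) * Real.exp (v * r ^ 2 / 2) =
      Real.exp (-a ^ 2 / (2 * v)) := by
    intro r hr
    rw [hr, ← Real.exp_add]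
    congr 1
    field_simp
    ring
  refine (measureReal_mono hsub).trans ((measureReal_union_le _ _).trans ?_)
  have h1 := tail (a / v)
  have h2 := tail (-(a / v))
  rw [hexp _ rfl] at h1
  rw [hexp _ (by ring)] at h2
  linarith

/-- With high probability, the gradient noise accumulated within a round is uniformly small. -/
theorem exists_noise_event (hm : ∀ θ, Measurable (ℓ θ)) (hi : ∀ θ, Integrable (ℓ θ) D)
    (hd : ∀ x, Differentiable ℝ (fun θ => ℓ θ x)) {G : ℝ} (hG0 : 0 < G)
    (hG : ∀ θ x, ‖∇ (fun y => ℓ y x) θ‖ ≤ G) (hL : Measurable (∇ (expectedLoss ℓ D)))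
    (hB : 0 < B) (hξ : ∀ i, Measurable (ξ i)) (hlaw : ∀ i, P.map (ξ i) = D)
    (hind : iIndepFun ξ P) (η : ℝ) {H : ℕ} (hH : 0 < H) (θ₀ : Param d) (S : ℕ) {a : ℝ}
    (ha : 0 ≤ a) :
    ∃ A : Set Ω, MeasurableSet A ∧
      1 - S * K * (H + 1) * d * (2 * Real.exp (-a ^ 2 / (2 * (H * (2 * G) ^ 2)))) ≤ P.real A ∧
      ∀ w ∈ A, ∀ s < S, ∀ k, ∀ t ≤ H,
        ‖noiseSum (expectedLoss ℓ D) ℓ η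
          (globalIter ℓ η H θ₀ (fun s k t i => ξ (s, k, t, i) w) s)
          (fun t i => ξ (s, k, t, i) w) t‖ ≤ √d * a := by
  classical
  have hgrad := measurable_gradient_uncurry hm hd
  set Y : ℕ × Fin K × ℕ × Fin d → Ω → ℝ := fun q w => (noiseSum (expectedLoss ℓ D) ℓ η
    (globalIter ℓ η H θ₀ (fun s k t i => ξ (s, k, t, i) w) q.1)
    (fun t i => ξ (q.1, q.2.1, t, i) w) q.2.2.1) q.2.2.2 with hY
  have hYm : ∀ q, Measurable (Y q) := fun q =>
    (EuclideanSpace.proj (𝕜 := ℝ) q.2.2.2).continuous.measurable.comp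
      (measurable_noiseSum hL hgrad η
        (measurable_globalIter hgrad η H θ₀ q.1 (fun _ _ _ _ _ => hξ _) q.1 le_rfl) _
        (fun _ _ _ => hξ _))
  set I : Finset (ℕ × Fin K × ℕ × Fin d) :=
    Finset.range S ×ˢ Finset.univ ×ˢ Finset.range (H + 1) ×ˢ Finset.univ with hI
  have hbad : ∀ q ∈ I, P.real {w | a < |Y q w|} ≤
      2 * Real.exp (-a ^ 2 / (2 * (H * (2 * G) ^ 2))) := by
    intro q hq
    refine measureReal_abs_ge_le (hYm q) (by positivity) ha fun r => ?_
    refine (lintegral_exp_noiseSum_le hm hi hd hG hL hB hξ hlaw hind η H θ₀ q.1 q.2.1 q.2.2.2 r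
      q.2.2.1).trans ?_
    refine ENNReal.ofReal_le_ofReal (Real.exp_le_exp.2 ?_)
    have hqt : (q.2.2.1 : ℝ) ≤ H := by
      have : q.2.2.1 < H + 1 := by simp [hI] at hq; omega
      exact_mod_cast Nat.lt_succ_iff.1 this
    calc (q.2.2.1 : ℝ) * ((2 * G) ^ 2 * r ^ 2 / 2) ≤ H * ((2 * G) ^ 2 * r ^ 2 / 2) := by gcongr
      _ = _ := by ring
  have hmeas : MeasurableSet (⋃ q ∈ I, {w | a < |Y q w|}) :=
    Finset.measurableSet_biUnion _ fun q _ => measurableSet_lt measurable_const (by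
      have := hYm q
      fun_prop)
  refine ⟨(⋃ q ∈ I, {w | a < |Y q w|})ᶜ, hmeas.compl, ?_, fun w hw s hs k t ht => ?_⟩
  · rw [probReal_compl_eq_one_sub hmeas]
    have h1 := (measureReal_biUnion_finset_le (μ := P) I fun q => {w | a < |Y q w|}).trans
      (Finset.sum_le_card_nsmul I _ _ hbad)
    have hcard : I.card = S * (K * ((H + 1) * d)) := by simp [hI, Finset.card_product]
    rw [hcard, nsmul_eq_mul] at h1
    push_cast at h1
    have : (S : ℝ) * K * (H + 1) * d = S * (K * ((H + 1) * d)) := by ring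
    rw [this]
    linarith
  · have hj : ∀ j, |Y (s, k, t, j) w| ≤ a := by
      intro j
      by_contra! hcon
      refine hw (mem_iUnion₂.2 ⟨(s, k, t, j), ?_, hcon⟩)
      simp only [hI, Finset.mem_product, Finset.mem_range, Finset.mem_univ, true_and, and_true]
      exact ⟨hs, by omega⟩
    rw [EuclideanSpace.norm_eq, Real.sqrt_le_left (by positivity), mul_pow,
      Real.sq_sqrt (Nat.cast_nonneg d)]
    calc _ ≤ ∑ _j : Fin d, a ^ 2 := by
          refine Finset.sum_le_sum fun j _ => ?_
          have := hj j
          rw [Real.norm_eq_abs]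
          gcongr
      _ = d * a ^ 2 := by simp

end Noise

end Probability

/-! ### Evolution of the global iterates under a noise bound. -/

section Deterministic

variable {d : ℕ} {X : Type*} {L : Param d → ℝ} {ℓ : Param d → X → ℝ} {G R ρ η N : ℝ} {K B H S : ℕ}
  {θ₀ : Param d} {x : ℕ → Fin K → ℕ → Fin B → X}

theorem norm_globalIter_sub_le (hG : ∀ θ x, ‖∇ (fun y => ℓ y x) θ‖ ≤ G) (hG0 : 0 ≤ G)
    (hη : 0 ≤ η) (hK : 0 < K) (s : ℕ) :
    ‖globalIter ℓ η H θ₀ x s - θ₀‖ ≤ G * (s * (H * η)) := by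
  induction s with
  | zero => simp [globalIter]
  | succ s ih =>
    rw [globalIter]
    refine norm_average_sub_le hK fun k => ?_
    have h1 := norm_localIter_sub_le hG hG0 hη (globalIter ℓ η H θ₀ x s) (x s k) H
    have h2 := norm_sub_le_norm_sub_add_norm_sub
      (localIter ℓ η (globalIter ℓ η H θ₀ x s) (x s k) H) (globalIter ℓ η H θ₀ x s) θ₀
    push_cast
    linarith

/-- The global iterates follow a gradient flow from the same starting point for a bounded number
of rounds. -/
theorem norm_globalIter_sub_flow_le
    (hG : ∀ θ x, ‖∇ (fun y => ℓ y x) θ‖ ≤ G) (hGL : ∀ θ, ‖∇ L θ‖ ≤ G) (hρ0 : 0 ≤ ρ)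
    (hρ : ∀ a ∈ closedBall (0 : Param d) R, ∀ b ∈ closedBall (0 : Param d) R,
      ‖∇ L a - ∇ L b‖ ≤ ρ * ‖a - b‖) (hη : 0 ≤ η) (hK : 0 < K) (hN0 : 0 ≤ N)
    (hN : ∀ s < S, ∀ k, ∀ t ≤ H,
      η * ‖noiseSum L ℓ η (globalIter ℓ η H θ₀ x s) (x s k) t‖ ≤ N)
    {y : ℝ → Param d} (hy : IsGradientFlow L y) (hy0 : y 0 = θ₀) {n : ℕ}
    (hR : ‖θ₀‖ + G * (n * (H * η)) ≤ R) (hnS : n ≤ S) :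
    ∀ s ≤ n, ‖globalIter ℓ η H θ₀ x s - y (s * (H * η))‖ ≤
      s * Real.exp (ρ * (H * η)) ^ s * (ρ * G * η * (H * η) + N) := by
  have hG0 : 0 ≤ G := (norm_nonneg _).trans (hGL 0)
  set M := Real.exp (ρ * (H * η)) with hM
  have hM1 : 1 ≤ M := Real.one_le_exp (by positivity)
  intro s
  induction s with
  | zero => simp [globalIter, hy0]
  | succ s ih =>
    intro hs
    have hmono : ‖θ₀‖ + G * (s * (H * η)) + G * (H * η) ≤ R := by
      have h1 : ((s : ℝ) + 1) ≤ n := by exact_mod_cast hs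
      have h2 : G * (((s : ℝ) + 1) * (H * η)) ≤ G * (n * (H * η)) := by gcongr
      linarith
    have hθR : ‖globalIter ℓ η H θ₀ x s‖ + G * (H * η) ≤ R := by
      linarith [norm_globalIter_sub_le (H := H) (θ₀ := θ₀) (x := x) hG hG0 hη hK s,
        norm_le_insert' (globalIter ℓ η H θ₀ x s) θ₀]
    have hyR : ‖y (0 + s * (H * η))‖ + G * (H * η) ≤ R := by
      have h1 := hy.norm_sub_le hGL le_rfl (t := 0 + s * (H * η)) (by positivity)
      rw [hy0] at h1
      linarith [norm_le_insert' (y (0 + s * (H * η))) θ₀]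
    have hshift := hy.shift (s := s * (H * η)) (by positivity)
    have h1 : ∀ k, ‖localIter ℓ η (globalIter ℓ η H θ₀ x s) (x s k) H -
        y ((s + 1 : ℕ) * (H * η))‖ ≤
        (‖globalIter ℓ η H θ₀ x s - y (s * (H * η))‖ + ρ * G * η * (H * η) + N) * M := by
      intro k
      have := norm_localIter_sub_flow_le hG hGL hρ0 hρ hη hshift hθR hyR
        (hN s (by omega) k) le_rfl
      rw [zero_add] at this
      rwa [show ((s + 1 : ℕ) : ℝ) * (H * η) = H * η + s * (H * η) by push_cast; ring]
    refine (norm_average_sub_le hK h1).trans ?_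
    have h2 := ih (by omega)
    have hb0 : 0 ≤ ρ * G * η * (H * η) + N := by positivity
    have hMs : 1 ≤ M ^ s := one_le_pow₀ hM1
    have h3 := le_mul_of_one_le_left hb0 hMs
    calc (‖globalIter ℓ η H θ₀ x s - y (s * (H * η))‖ + ρ * G * η * (H * η) + N) * M
        ≤ (s * M ^ s * (ρ * G * η * (H * η) + N) + M ^ s * (ρ * G * η * (H * η) + N)) * M := by
          refine mul_le_mul_of_nonneg_right ?_ (zero_le_one.trans hM1)
          linarith
      _ = _ := by rw [pow_succ]; push_cast; ring

variable {Γ : Set (Param d)} {Lmin ε κ c ρ' : ℝ}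

/-- The flow is restarted at the current global iterate, so there is no initial tracking error. Over
one round it contracts the potential, and the averaged workers differ from its endpoint by at most
the tracking error, which costs a factor `√ρ'`. Endpoint distance and tracking error are each at
most `ε / 4`, so the tube is not left. -/
theorem globalIter_succ_near (hL : ContDiff ℝ ∞ L)
    (hG : ∀ θ x, ‖∇ (fun y => ℓ y x) θ‖ ≤ G) (hGL : ∀ θ, ‖∇ L θ‖ ≤ G) (hρ0 : 0 ≤ ρ)
    (hρ : ∀ a ∈ closedBall (0 : Param d) R, ∀ b ∈ closedBall (0 : Param d) R,
      ‖∇ L a - ∇ L b‖ ≤ ρ * ‖a - b‖) (hη : 0 ≤ η) (hK : 0 < K)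
    (h : IsPLNeighborhood L Γ Lmin ε κ c ρ')
    (hR : ∀ θ, infDist θ Γ < ε → ‖θ‖ + G * (H * η) ≤ R) {s : ℕ}
    (hN : ∀ k, ∀ t ≤ H, η * ‖noiseSum L ℓ η (globalIter ℓ η H θ₀ x s) (x s k) t‖ ≤ N)
    (hβ : (ρ * G * η * (H * η) + N) * Real.exp (ρ * (H * η)) ≤ ε / 4)
    (hs : infDist (globalIter ℓ η H θ₀ x s) Γ < ε)
    (hs' : √(L (globalIter ℓ η H θ₀ x s) - Lmin) ≤ √κ * (ε / 4)) :
    infDist (globalIter ℓ η H θ₀ x (s + 1)) Γ < ε ∧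
    √(L (globalIter ℓ η H θ₀ x (s + 1)) - Lmin) ≤
      Real.exp (-(c / 2) * (H * η)) * √(L (globalIter ℓ η H θ₀ x s) - Lmin) +
        √ρ' * ((ρ * G * η * (H * η) + N) * Real.exp (ρ * (H * η))) := by
  have hε := h.eps_pos
  have hκ : 0 < √κ := Real.sqrt_pos.2 h.kappa_pos
  have hLd : Differentiable ℝ L := hL.differentiable (by simp)
  obtain ⟨y, hy0, hy⟩ := exists_isGradientFlow hL hGL (globalIter ℓ η H θ₀ x s)
  have hd4 : √(L (y 0) - Lmin) / √κ ≤ ε / 4 := by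
    rw [hy0, div_le_iff₀ hκ]; linarith
  have hd2 : √(L (y 0) - Lmin) / √κ < ε / 2 := by linarith
  have hs0 : infDist (y 0) Γ < ε := by rwa [hy0]
  have hα : 0 ≤ (H : ℝ) * η := by positivity
  have hstep : ‖globalIter ℓ η H θ₀ x (s + 1) - y (H * η)‖ ≤
      (ρ * G * η * (H * η) + N) * Real.exp (ρ * (H * η)) := by
    refine norm_average_sub_le hK fun k => ?_
    have := norm_localIter_sub_flow_le hG hGL hρ0 hρ hη hy (hR _ hs) (hR _ hs0) (hN k) le_rfl
    rwa [hy0, sub_self, norm_zero, zero_add] at this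
  have hsq := hy.sqrt_le hLd h hs0 hd2 hα
  have hyα := hy.infDist_lt hLd h hs0 hd2 hα
  have hyα4 : infDist (y (H * η)) Γ ≤ ε / 4 := by
    refine (h.infDist_le hyα).trans (le_trans ?_ hd4)
    gcongr
    exact hy.antitoneOn hLd (mem_Ici.2 le_rfl) (mem_Ici.2 hα) hα
  have hnew : infDist (globalIter ℓ η H θ₀ x (s + 1)) Γ < ε := by
    have h1 : infDist (globalIter ℓ η H θ₀ x (s + 1)) Γ ≤ infDist (y (H * η)) Γ +
      dist (globalIter ℓ η H θ₀ x (s + 1)) (y (H * η)) := infDist_le_infDist_add_dist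
    rw [dist_eq_norm] at h1
    linarith
  refine ⟨hnew, (h.sqrt_sub_le hyα hnew).trans ?_⟩
  rw [hy0] at hsq
  gcongr

/-- Iteration of `v ↦ q * v + √ρ' * β`, whose fixed point is `√ρ' * β / (1 - q)`; `hβ'` says
precisely that the level `√κ * (ε / 4)` is not exceeded. -/
theorem globalIter_near (hL : ContDiff ℝ ∞ L)
    (hG : ∀ θ x, ‖∇ (fun y => ℓ y x) θ‖ ≤ G) (hGL : ∀ θ, ‖∇ L θ‖ ≤ G) (hρ0 : 0 ≤ ρ)
    (hρ : ∀ a ∈ closedBall (0 : Param d) R, ∀ b ∈ closedBall (0 : Param d) R,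
      ‖∇ L a - ∇ L b‖ ≤ ρ * ‖a - b‖) (hη : 0 ≤ η) (hK : 0 < K)
    (h : IsPLNeighborhood L Γ Lmin ε κ c ρ')
    (hR : ∀ θ, infDist θ Γ < ε → ‖θ‖ + G * (H * η) ≤ R)
    (hN : ∀ s < S, ∀ k, ∀ t ≤ H,
      η * ‖noiseSum L ℓ η (globalIter ℓ η H θ₀ x s) (x s k) t‖ ≤ N) {q β : ℝ}
    (hβe : (ρ * G * η * (H * η) + N) * Real.exp (ρ * (H * η)) = β) (hβ0 : 0 ≤ β)
    (hβ : β ≤ ε / 4) (hqe : Real.exp (-(c / 2) * (H * η)) = q) (hq1 : q < 1)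
    (hβ' : √ρ' * β ≤ (1 - q) * (√κ * (ε / 4))) {s₀ : ℕ}
    (hs : infDist (globalIter ℓ η H θ₀ x s₀) Γ < ε)
    (hs' : √(L (globalIter ℓ η H θ₀ x s₀) - Lmin) ≤ √κ * (ε / 4)) (n : ℕ) (hn : s₀ + n ≤ S) :
    infDist (globalIter ℓ η H θ₀ x (s₀ + n)) Γ < ε ∧
    √(L (globalIter ℓ η H θ₀ x (s₀ + n)) - Lmin) ≤ √κ * (ε / 4) ∧
    √(L (globalIter ℓ η H θ₀ x (s₀ + n)) - Lmin) ≤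
      q ^ n * (√κ * (ε / 4)) + √ρ' * β / (1 - q) := by
  have hq0 : 0 ≤ q := hqe ▸ (Real.exp_pos _).le
  have hq1' : 0 < 1 - q := by linarith
  induction n with
  | zero =>
    refine ⟨hs, hs', hs'.trans ?_⟩
    rw [pow_zero, one_mul]
    exact le_add_of_nonneg_right (by positivity)
  | succ n ih =>
    obtain ⟨h1, h2, h3⟩ := ih (by omega)
    obtain ⟨h4, h5⟩ := globalIter_succ_near hL hG hGL hρ0 hρ hη hK h hR (hN (s₀ + n) (by omega))
      (hβe ▸ hβ) h1 h2
    rw [hβe, hqe] at h5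
    refine ⟨h4, h5.trans ?_, h5.trans ?_⟩
    · nlinarith
    · have h6 := mul_le_mul_of_nonneg_left h3 hq0
      have h7 : √ρ' * β / (1 - q) = q * (√ρ' * β / (1 - q)) + √ρ' * β := by
        field_simp; ring
      rw [pow_succ]
      linarith

end Deterministic

/-! ### Choice of scales and assembly of the deterministic estimate. -/

theorem one_le_log_of_le_exp {η δ : ℝ} (hη : 0 < η) (hη1 : η ≤ Real.exp (-1)) (hδ : 0 < δ)
    (hδ1 : δ < 1) : 1 ≤ Real.log (1 / (η * δ)) := by
  rw [one_div, Real.log_inv, le_neg, Real.log_le_iff_le_exp (by positivity)]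
  nlinarith

/-- As `δ ≥ η ^ p`, the logarithm is at most `(p + 1) log (1 / η)`. Hence the error scale tends to
zero with `η` uniformly in `δ`, and `p` affects only the threshold `η₀`. -/
theorem mul_log_le {η δ : ℝ} {p : ℕ} (hη : 0 < η) (hδ : η ^ p ≤ δ) :
    η * Real.log (1 / (η * δ)) ≤ 2 * (p + 1) * √η := by
  have h1 : Real.log (1 / (η * δ)) ≤ (p + 1) * Real.log (1 / η) := by
    have h2 : 1 / (η * δ) ≤ (1 / η) ^ (p + 1) := by
      rw [one_div_pow]
      gcongr
      rw [pow_succ, mul_comm]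
      gcongr
    have hδ0 : 0 < δ := (pow_pos hη p).trans_le hδ
    have h3 := Real.log_le_log (by positivity) h2
    rwa [Real.log_pow, Nat.cast_add, Nat.cast_one] at h3
  have h4 : η * Real.log (1 / η) ≤ 2 * √η := by
    have hs : 0 < √η := Real.sqrt_pos.2 hη
    have h5 : Real.log (1 / η) = 2 * Real.log (1 / √η) := by
      rw [one_div, one_div, Real.log_inv, Real.log_inv, Real.log_sqrt hη.le]; ring
    have h6 := Real.log_le_sub_one_of_pos (show 0 < 1 / √η by positivity)
    calc η * Real.log (1 / η) ≤ η * (2 * (1 / √η)) := by rw [h5]; gcongr; linarith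
      _ = 2 * (η / √η) := by ring
      _ = 2 * √η := by rw [Real.div_sqrt]
  calc _ ≤ η * ((p + 1) * Real.log (1 / η)) := by gcongr
    _ = (p + 1) * (η * Real.log (1 / η)) := by ring
    _ ≤ (p + 1) * (2 * √η) := by gcongr
    _ = _ := by ring

/-- The probability that some noise term is large. -/
theorem failure_probability_le {η δ α T : ℝ} {H S K d : ℕ} (hη : 0 < η) (hδ : 0 < δ) (hδ1 : δ < 1)
    (hα : 0 < α) (hT : 0 < T) (hH : (H : ℝ) = α / η) (hH1 : 1 ≤ H)
    (hS : (S : ℝ) ≤ T / (H * η ^ 2)) (hsmall : 4 * T * K * d * η ≤ 1) :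
    S * K * (H + 1) * d * (2 * Real.exp (-(3 * Real.log (1 / (η * δ))))) ≤ δ := by
  have hexp : Real.exp (-(3 * Real.log (1 / (η * δ)))) = (η * δ) ^ 3 := by
    rw [one_div, Real.log_inv, mul_neg, neg_neg, ← Real.log_rpow (by positivity),
      Real.exp_log (by positivity)]
    norm_cast
  have h1 : (H : ℝ) + 1 ≤ 2 * (α / η) := by
    rw [← hH]
    have : (1 : ℝ) ≤ H := by exact_mod_cast hH1
    linarith
  have h2 : (S : ℝ) ≤ T / (α * η) := by
    refine hS.trans_eq ?_
    rw [hH]; field_simp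
  rw [hexp]
  -- The number of noise terms is of order `η⁻²`; the cube `(η * δ) ^ 3` therefore leaves a spare
  -- factor `η`, absorbed by `hsmall`.
  calc S * K * (H + 1) * d * (2 * (η * δ) ^ 3)
      ≤ T / (α * η) * K * (2 * (α / η)) * d * (2 * (η * δ) ^ 3) := by gcongr
    _ = (4 * T * K * d * η) * (δ * δ ^ 2) := by field_simp; ring
    _ ≤ 1 * (δ * 1) := by
        gcongr
        exact pow_le_one₀ hδ.le hδ1.le
    _ = δ := by ring

/-- The admissible region is an open neighbourhood of the limit `φ`, and the flow sampled at
multiples of `α` enters it. Neither `s₀` nor `r` depends on `η`. -/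
theorem exists_round_near {d : ℕ} {L : Param d → ℝ} (hL : Continuous L) {Γ : Set (Param d)}
    {Lmin ε κ c ρ : ℝ} (h : IsPLNeighborhood L Γ Lmin ε κ c ρ) {y : ℝ → Param d} {φ : Param d}
    (hφ : φ ∈ Γ) (hy : Tendsto y atTop (𝓝 φ)) {α : ℝ} (hα : 0 < α) :
    ∃ s₀ : ℕ, ∃ r > 0, ∀ θ, ‖θ - y (s₀ * α)‖ < r →
      infDist θ Γ < ε ∧ √(L θ - Lmin) ≤ √κ * (ε / 4) := by
  have hκ : 0 < √κ := Real.sqrt_pos.2 h.kappa_pos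
  have hε := h.eps_pos
  set O := {θ : Param d | infDist θ Γ < ε ∧ √(L θ - Lmin) < √κ * (ε / 4)} with hO
  have hopen : IsOpen O :=
    (isOpen_lt (continuous_infDist_pt Γ) continuous_const).inter
      (isOpen_lt (hL.sub continuous_const).sqrt continuous_const)
  have hφO : φ ∈ O := by
    refine ⟨by rw [infDist_zero_of_mem hφ]; exact hε, ?_⟩
    rw [h.eq_min φ hφ, sub_self, Real.sqrt_zero]
    positivity
  have hlim : Tendsto (fun n : ℕ => y (n * α)) atTop (𝓝 φ) :=
    hy.comp (tendsto_natCast_atTop_atTop.atTop_mul_const hα)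
  obtain ⟨s₀, hs₀⟩ := (hlim.eventually (hopen.mem_nhds hφO)).exists
  obtain ⟨r, hr, hball⟩ := Metric.isOpen_iff.1 hopen _ hs₀
  refine ⟨s₀, r, hr, fun θ hθ => ?_⟩
  have := hball (show θ ∈ ball (y (s₀ * α)) r by rwa [mem_ball, dist_eq_norm])
  exact ⟨this.1, this.2.le⟩

theorem flowProj_near {d : ℕ} {L : Param d → ℝ} (hL : ContDiff ℝ ∞ L) {G : ℝ}
    (hGL : ∀ θ, ‖∇ L θ‖ ≤ G) {Γ : Set (Param d)} (hΓ : IsClosed Γ) (hne : Γ.Nonempty)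
    {Lmin ε κ c ρ : ℝ} (h : IsPLNeighborhood L Γ Lmin ε κ c ρ) {θnull θ : Param d}
    (hnull : θnull ∉ Γ) (h0 : infDist θ Γ < ε) (h1 : √(L θ - Lmin) ≤ √κ * (ε / 4)) :
    flowProj L Γ θnull θ ∈ Γ ∧ ∃ y, y 0 = θ ∧ IsGradientFlow L y ∧
      ∀ s, 0 ≤ s → ‖y s - flowProj L Γ θnull θ‖ ≤ 4 * √ρ / c * √(L θ - Lmin) := by
  have hLd : Differentiable ℝ L := hL.differentiable (by simp)
  have hε := h.eps_pos
  have h1' : √(L θ - Lmin) / √κ < ε / 2 := by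
    rw [div_lt_iff₀ (Real.sqrt_pos.2 h.kappa_pos)]
    nlinarith [Real.sqrt_pos.2 h.kappa_pos]
  have hmem : flowProj L Γ θnull θ ∈ Γ := by
    obtain ⟨x, rfl, hx⟩ := exists_isGradientFlow hL hGL θ
    obtain ⟨φ, hφ, hlim⟩ := hx.exists_tendsto hLd hΓ hne h h0 h1'
    exact flowProj_mem hφ ⟨x, rfl, hx, hlim⟩
  obtain ⟨y, hy0, hy, hlim⟩ := exists_isGradientFlow_of_flowProj_mem hnull hmem
  refine ⟨hmem, y, hy0, hy, fun s hs => ?_⟩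
  rw [← hy0] at h0 h1' hlim ⊢
  exact hy.norm_sub_lim_le hLd h h0 h1' hlim hs

theorem exp_pow_le_sqrt {b η : ℝ} {n : ℕ} (hη : 0 < η) (h : Real.log (1 / η) ≤ 2 * b * n) :
    Real.exp (-b) ^ n ≤ √η := by
  rw [← Real.exp_nat_mul, ← Real.exp_log (Real.sqrt_pos.2 hη), Real.log_sqrt hη.le]
  rw [one_div, Real.log_inv] at h
  gcongr
  linarith

/-- The deterministic part of the argument: if the gradient noise accumulated within each round is
at most of order `σ`, then after logarithmically many rounds the iterates are `O(σ)`-close to the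
minimizing manifold. -/
theorem exists_near_of_noise_le {d : ℕ} {X : Type*} {L : Param d → ℝ} (hL : ContDiff ℝ ∞ L)
    {ℓ : Param d → X → ℝ} {G : ℝ} (hG0 : 0 < G) (hG : ∀ θ x, ‖∇ (fun y => ℓ y x) θ‖ ≤ G)
    (hGL : ∀ θ, ‖∇ L θ‖ ≤ G) {Γ : Set (Param d)} (hcpt : IsCompact Γ)
    {Lmin ε κ c ρ' : ℝ} (h : IsPLNeighborhood L Γ Lmin ε κ c ρ') {θnull θ₀ : Param d}
    (hnull : θnull ∉ Γ) (hθ₀ : flowProj L Γ θnull θ₀ ∈ Γ) {K B : ℕ} (hK : 0 < K) {α b : ℝ}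
    (hα : 0 < α) (hb : 0 ≤ b) :
    ∃ C₁ C₂ σ₀ : ℝ, 0 < C₁ ∧ 0 < C₂ ∧ 0 < σ₀ ∧ ∀ (η σ : ℝ) (H S : ℕ)
      (x : ℕ → Fin K → ℕ → Fin B → X), 0 < η → η ≤ Real.exp (-1) → H * η = α → √η ≤ σ → σ ≤ σ₀ →
      (∀ s < S, ∀ k, ∀ t ≤ H,
        η * ‖noiseSum L ℓ η (globalIter ℓ η H θ₀ x s) (x s k) t‖ ≤ b * σ) →
      ∀ s : ℕ, C₁ * Real.log (1 / η) ≤ s → s ≤ S →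
        flowProj L Γ θnull (globalIter ℓ η H θ₀ x s) ∈ Γ ∧
        ‖globalIter ℓ η H θ₀ x s - flowProj L Γ θnull (globalIter ℓ η H θ₀ x s)‖ ≤ C₂ * σ ∧
        (s < S → ∀ k, ∀ t ≤ H, ‖localIter ℓ η (globalIter ℓ η H θ₀ x s) (x s k) t -
          flowProj L Γ θnull (globalIter ℓ η H θ₀ x s)‖ ≤ C₂ * σ) := by
  have hne : Γ.Nonempty := ⟨_, hθ₀⟩
  have hε := h.eps_pos
  have hc := h.c_pos
  have hρ' := h.rho_pos
  have hκ : 0 < √κ := Real.sqrt_pos.2 h.kappa_pos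
  obtain ⟨y, hy0, hy, hylim⟩ := exists_isGradientFlow_of_flowProj_mem hnull hθ₀
  obtain ⟨s₀, r, hr, hs₀⟩ := exists_round_near hL.continuous h hθ₀ hylim hα
  obtain ⟨RΓ, hRΓ⟩ := hcpt.isBounded.subset_closedBall (0 : Param d)
  have hRΓ0 : 0 ≤ RΓ := dist_nonneg.trans (mem_closedBall.1 (hRΓ hθ₀))
  obtain ⟨R, hRnear, hRstart⟩ : ∃ R, (∀ θ, infDist θ Γ < ε → ‖θ‖ + G * α ≤ R) ∧
      ‖θ₀‖ + G * (s₀ * α) ≤ R := by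
    have h1 : 0 ≤ G * (s₀ * α) := by positivity
    have h2 : 0 ≤ G * α := by positivity
    refine ⟨‖θ₀‖ + G * (s₀ * α) + RΓ + ε + G * α, fun θ hθ => ?_, by linarith⟩
    obtain ⟨q, hq, hdq⟩ := (infDist_lt_iff hne).1 hθ
    have h3 := hRΓ hq
    rw [mem_closedBall_zero_iff] at h3
    rw [dist_eq_norm] at hdq
    linarith [norm_le_insert' θ q, norm_nonneg θ₀]
  obtain ⟨ρ, hρ0, hρ⟩ := exists_lipschitz_gradient hL R
  obtain ⟨M, hM⟩ : ∃ M, Real.exp (ρ * α) = M := ⟨_, rfl⟩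
  have hM0 : 0 < M := hM ▸ Real.exp_pos _
  obtain ⟨q, hq⟩ : ∃ q, Real.exp (-(c / 2) * α) = q := ⟨_, rfl⟩
  have hq1 : 0 < 1 - q := by
    have : q < 1 := hq ▸ Real.exp_lt_one_iff.2 (by nlinarith)
    linarith
  obtain ⟨Ψ, hΨ⟩ : ∃ Ψ, √κ * (ε / 4) = Ψ := ⟨_, rfl⟩
  have hΨ0 : 0 < Ψ := by rw [← hΨ]; positivity
  obtain ⟨C₀, hC₀⟩ : ∃ C₀, ρ * G * α + b = C₀ := ⟨_, rfl⟩
  have hC₀0 : 0 < C₀ := by rw [← hC₀]; positivity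
  obtain ⟨CA, hCA⟩ : ∃ CA, 4 * √ρ' / c * (Ψ + √ρ' * (C₀ * M) / (1 - q)) = CA := ⟨_, rfl⟩
  have hCA0 : 0 < CA := by rw [← hCA]; positivity
  obtain ⟨σ₀, hσ₀, hσr, hσε, hσΨ⟩ : ∃ σ₀ > 0, s₀ * M ^ s₀ * (C₀ * σ₀) < r ∧
      C₀ * σ₀ * M ≤ ε / 4 ∧ √ρ' * (C₀ * σ₀ * M) ≤ (1 - q) * Ψ := by
    have e1 : ∀ᶠ σ in 𝓝 (0 : ℝ), s₀ * M ^ s₀ * (C₀ * σ) < r := by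
      refine ContinuousAt.eventually_lt (by fun_prop) continuousAt_const ?_
      simpa using hr
    have e2 : ∀ᶠ σ in 𝓝 (0 : ℝ), C₀ * σ * M < ε / 4 := by
      refine ContinuousAt.eventually_lt (by fun_prop) continuousAt_const ?_
      simpa using hε
    have e3 : ∀ᶠ σ in 𝓝 (0 : ℝ), √ρ' * (C₀ * σ * M) < (1 - q) * Ψ := by
      refine ContinuousAt.eventually_lt (by fun_prop) continuousAt_const ?_
      simpa using mul_pos hq1 hΨ0
    have e := (((e1.and e2).and e3).filter_mono
      (nhdsWithin_le_nhds (s := Ioi 0))).and self_mem_nhdsWithin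
    obtain ⟨σ, ⟨⟨h1, h2⟩, h3⟩, h4⟩ := e.exists
    exact ⟨σ, h4, h1, h2.le, h3.le⟩
  -- `C₁` pays for `s₀` rounds of entering the tube (as `log (1 / η) ≥ 1`) and `log (1 / η) / (c α)`
  -- rounds until `q ^ n ≤ √η ≤ σ`. In `C₂`, `CA` bounds the distance from the flow to its limit and
  -- `C₀ * M` the deviation of a worker from the flow.
  refine ⟨s₀ + 1 / (c * α), CA + C₀ * M, σ₀, by positivity, by positivity, hσ₀, ?_⟩
  intro η σ H S x hη hη1 hHη hησ hσσ₀ hN s hs hsS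
  have hlogη : 1 ≤ Real.log (1 / η) := by
    rw [one_div, Real.log_inv, le_neg, Real.log_le_iff_le_exp hη]
    exact hη1
  have hσ0 : 0 ≤ σ := (Real.sqrt_nonneg η).trans hησ
  have hη2 : η ≤ 1 := hη1.trans (Real.exp_le_one_iff.2 (by norm_num))
  have hησ' : η ≤ σ := le_trans (Real.le_sqrt_of_sq_le (pow_le_of_le_one hη.le hη2 two_ne_zero)) hησ
  have hbσ : 0 ≤ b * σ := by positivity
  have hβ₀ : ρ * G * η * α + b * σ ≤ C₀ * σ := by
    have h1 : ρ * G * α * η ≤ ρ * G * α * σ := by gcongr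
    rw [← hC₀]
    linarith
  have hC₀σ : C₀ * σ ≤ C₀ * σ₀ := by gcongr
  obtain ⟨β, hβ⟩ : ∃ β, (ρ * G * η * α + b * σ) * M = β := ⟨_, rfl⟩
  have hβ0 : 0 ≤ β := by rw [← hβ]; positivity
  have hβσ : β ≤ C₀ * σ * M := by rw [← hβ]; gcongr
  have hβσ₀ : β ≤ C₀ * σ₀ * M := hβσ.trans (by gcongr)
  have hβΨ : √ρ' * β ≤ (1 - q) * Ψ :=
    (mul_le_mul_of_nonneg_left hβσ₀ (Real.sqrt_nonneg _)).trans hσΨ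
  rw [add_mul] at hs
  have hs₀log := le_mul_of_one_le_right (Nat.cast_nonneg (α := ℝ) s₀) hlogη
  have hs₀s : (s₀ : ℝ) ≤ s := by
    have h1 : 0 ≤ 1 / (c * α) * Real.log (1 / η) := by positivity
    linarith
  obtain ⟨n, rfl⟩ := Nat.exists_eq_add_of_le (show s₀ ≤ s by exact_mod_cast hs₀s)
  have hqn : q ^ n ≤ √η := by
    rw [← hq, neg_mul]
    refine exp_pow_le_sqrt hη ?_
    push_cast at hs
    have h1 : 1 / (c * α) * Real.log (1 / η) ≤ n := by linarith
    rw [one_div_mul_eq_div, div_le_iff₀ (by positivity)] at h1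
    linarith
  have hstart := norm_globalIter_sub_flow_le (S := S) (x := x) hG hGL hρ0.le hρ hη.le hK hbσ
    hN hy hy0 (n := s₀) (by rw [hHη]; exact hRstart) (by omega) s₀ le_rfl
  rw [hHη, hM] at hstart
  have hstart' := hs₀ _ (hstart.trans_lt (lt_of_le_of_lt
    (mul_le_mul_of_nonneg_left (hβ₀.trans hC₀σ) (by positivity)) hσr))
  have hRnear' : ∀ θ, infDist θ Γ < ε → ‖θ‖ + G * (H * η) ≤ R := by rwa [hHη]
  obtain ⟨h1, h2, h3⟩ := globalIter_near (S := S) (x := x) hL hG hGL hρ0.le hρ hη.le hK h hRnear'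
    hN (by rw [hHη, hM, hβ]) hβ0 (hβσ₀.trans hσε) (by rw [hHη, hq]) (by linarith)
    (by rw [hΨ]; exact hβΨ) hstart'.1 hstart'.2 n hsS
  rw [hΨ] at h3
  have hV : 4 * √ρ' / c * √(L (globalIter ℓ η H θ₀ x (s₀ + n)) - Lmin) ≤ CA * σ := by
    rw [← hCA, mul_assoc]
    have h4 : q ^ n * Ψ ≤ σ * Ψ := mul_le_mul_of_nonneg_right (hqn.trans hησ) hΨ0.le
    have h5 : √ρ' * β / (1 - q) ≤ √ρ' * (C₀ * σ * M) / (1 - q) := by gcongr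
    have h6 : √ρ' * (C₀ * σ * M) / (1 - q) = √ρ' * (C₀ * M) / (1 - q) * σ := by ring
    refine mul_le_mul_of_nonneg_left ?_ (by positivity)
    linarith
  have hCM : 0 ≤ C₀ * M * σ := by positivity
  obtain ⟨h4, z, hz0, hz, hzb⟩ := flowProj_near hL hGL hcpt.isClosed hne h hnull h1 h2
  refine ⟨h4, ?_, fun hsS' k t ht => ?_⟩
  · have h5 := hzb 0 le_rfl
    rw [hz0] at h5
    linarith
  -- The whole flow `z`, not only its starting point, is within `CA * σ` of the projection, and the
  -- worker tracks `z`.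
  · have h5 := hzb (t * η) (by positivity)
    have h6 := norm_localIter_sub_flow_le hG hGL hρ0.le hρ hη.le hz (hRnear' _ h1)
      (by rw [hz0]; exact hRnear' _ h1) (hN _ hsS' k) ht
    rw [hHη, hz0, sub_self, norm_zero, zero_add, hM, hβ] at h6
    have h7 := norm_sub_le_norm_sub_add_norm_sub
      (localIter ℓ η (globalIter ℓ η H θ₀ x (s₀ + n)) (x (s₀ + n) k) t) (z (t * η))
      (flowProj L Γ θnull (globalIter ℓ η H θ₀ x (s₀ + n)))
    linarith

end LocalSGD
end

/-! ### The main theorem. -/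

theorem mainTheorem7
    {d m : ℕ} {X : Type*} [MeasurableSpace X]
    (D : MeasureTheory.Measure X) [MeasureTheory.IsProbabilityMeasure D]
    (ℓ : LocalSGD.Param d → X → ℝ)
    (hℓ_meas : ∀ θ, Measurable (ℓ θ))
    (hℓ_int : ∀ θ, MeasureTheory.Integrable (ℓ θ) D)
    (hℓ_diff : ∀ x, Differentiable ℝ (fun θ => ℓ θ x))
    (hℓ_bdd : ∃ G : ℝ, ∀ θ x, ‖∇ (fun y => ℓ y x) θ‖ ≤ G)
    (hL : ContDiff ℝ ∞ (LocalSGD.expectedLoss ℓ D))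
    (Γ : Set (LocalSGD.Param d))
    (hΓ_mfd : LocalSGD.IsSmoothSubmanifold m Γ)
    (hΓ_rank : ∀ φ ∈ Γ, LocalSGD.hessianRank (LocalSGD.expectedLoss ℓ D) φ = m)
    (hΓ_min : ∃ U : Set (LocalSGD.Param d), IsOpen U ∧
      Γ = {θ ∈ U | ∀ θ' ∈ U, LocalSGD.expectedLoss ℓ D θ ≤ LocalSGD.expectedLoss ℓ D θ'})
    (hΓ_cpt : IsCompact Γ)
    (θnull : LocalSGD.Param d) (hnull : θnull ∉ Γ)
    (θ₀ : LocalSGD.Param d)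
    (hθ₀ : LocalSGD.flowProj (LocalSGD.expectedLoss ℓ D) Γ θnull θ₀ ∈ Γ)
    (K B : ℕ) (hK : 0 < K) (hB : 0 < B)
    (α T : ℝ) (hα : 0 < α) (hT : 0 < T) :
    ∃ C₁ C₂ : ℝ, 0 < C₁ ∧ 0 < C₂ ∧ ∀ p : ℕ, ∃ η₀ : ℝ, 0 < η₀ ∧ η₀ < 1 ∧
      ∀ (η δ : ℝ) (H : ℕ), 0 < η → η ≤ η₀ → (H : ℝ) = α / η → η ^ p ≤ δ → δ < 1 →
      ∀ {Ω : Type*} [MeasurableSpace Ω] (P : MeasureTheory.Measure Ω)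
        [MeasureTheory.IsProbabilityMeasure P]
        (ξ : ℕ × Fin K × ℕ × Fin B → Ω → X),
        (∀ i, Measurable (ξ i)) → (∀ i, P.map (ξ i) = D) → ProbabilityTheory.iIndepFun ξ P →
      let batch : Ω → ℕ → Fin K → ℕ → Fin B → X := fun w s k t i => ξ (s, k, t, i) w
      let Φ := LocalSGD.flowProj (LocalSGD.expectedLoss ℓ D) Γ θnull
      let θbar : Ω → ℕ → LocalSGD.Param d := fun w s =>
        LocalSGD.globalIter ℓ η H θ₀ (batch w) s
      let θloc : Ω → ℕ → Fin K → ℕ → LocalSGD.Param d := fun w s k t =>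
        LocalSGD.localIter ℓ η (θbar w s) (batch w s k) t
      ∃ A : Set Ω, MeasurableSet A ∧ 1 - δ ≤ P.real A ∧ ∀ w ∈ A,
        (∀ s : ℕ, C₁ * Real.log (1 / η) ≤ s → s ≤ ⌊T / (H * η ^ 2)⌋₊ →
          Φ (θbar w s) ∈ Γ ∧
          ‖θbar w s - Φ (θbar w s)‖ ≤ C₂ * √(η * Real.log (1 / (η * δ)))) ∧
        (∀ s : ℕ, C₁ * Real.log (1 / η) ≤ s → s < ⌊T / (H * η ^ 2)⌋₊ →
          ∀ (k : Fin K) (t : ℕ), t ≤ H →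
            ‖θloc w s k t - Φ (θbar w s)‖ ≤ C₂ * √(η * Real.log (1 / (η * δ)))) := by
  obtain ⟨G, hG0, hG⟩ : ∃ G : ℝ, 0 < G ∧ ∀ θ x, ‖∇ (fun y => ℓ y x) θ‖ ≤ G := by
    obtain ⟨G, hG⟩ := hℓ_bdd
    exact ⟨max G 1, by positivity, fun θ x => (hG θ x).trans (le_max_left _ _)⟩
  have hGL := LocalSGD.norm_gradient_expectedLoss_le (D := D) hℓ_meas hℓ_int hℓ_diff hG
  have hgm : Measurable (∇ (LocalSGD.expectedLoss ℓ D)) :=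
    (LocalSGD.contDiff_gradient hL).continuous.measurable
  obtain ⟨Lmin, ε, κ, c, ρ', h⟩ :=
    LocalSGD.exists_isPLNeighborhood hL hΓ_mfd hΓ_cpt ⟨_, hθ₀⟩ hΓ_rank hΓ_min
  obtain ⟨C₁, C₂, σ₀, hC₁, hC₂, hσ₀, hdet⟩ := LocalSGD.exists_near_of_noise_le (B := B)
    (b := √d * (G * √(24 * α))) hL hG0 hG hGL hΓ_cpt h hnull hθ₀ hK hα (by positivity)
  refine ⟨C₁, C₂, hC₁, hC₂, fun p => ?_⟩
  -- The three bounds ensure, in turn, `log (1 / (η δ)) ≥ 1`, a failure probability of at most `δ`,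
  -- and an error scale of at most `σ₀`.
  refine ⟨min (Real.exp (-1)) (min (1 / (4 * T * K * d + 1)) ((σ₀ ^ 2 / (2 * (p + 1))) ^ 2)),
    by positivity, (min_le_left _ _).trans_lt (Real.exp_lt_one_iff.2 (by norm_num)), ?_⟩
  intro η δ H hη hη₀ hH hδ hδ1 Ω _ P _ ξ hξ hlaw hind batch Φ θbar θloc
  have hη1 : η ≤ Real.exp (-1) := hη₀.trans (min_le_left _ _)
  have hη2 : η ≤ 1 / (4 * T * K * d + 1) :=
    hη₀.trans ((min_le_right _ _).trans (min_le_left _ _))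
  have hη3 : η ≤ (σ₀ ^ 2 / (2 * (p + 1))) ^ 2 :=
    hη₀.trans ((min_le_right _ _).trans (min_le_right _ _))
  have hδ0 : 0 < δ := (pow_pos hη p).trans_le hδ
  have hΛ1 := LocalSGD.one_le_log_of_le_exp hη hη1 hδ0 hδ1
  have hησ : √η ≤ √(η * Real.log (1 / (η * δ))) := Real.sqrt_le_sqrt (by nlinarith)
  have hσσ₀ : √(η * Real.log (1 / (η * δ))) ≤ σ₀ := by
    rw [Real.sqrt_le_left hσ₀.le]
    refine (LocalSGD.mul_log_le hη hδ).trans ?_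
    have h1 : √η ≤ σ₀ ^ 2 / (2 * (p + 1)) := (Real.sqrt_le_left (by positivity)).2 hη3
    rwa [le_div_iff₀ (by positivity), mul_comm] at h1
  have hHη : (H : ℝ) * η = α := by rw [hH, div_mul_cancel₀ _ hη.ne']
  have hH0 : (0 : ℝ) < H := by rw [hH]; positivity
  have hH1 : 0 < H := by exact_mod_cast hH0
  have hSle : (⌊T / (H * η ^ 2)⌋₊ : ℝ) ≤ T / (H * η ^ 2) := Nat.floor_le (by positivity)
  -- The constant `24` makes the Chernoff exponent `a² / (8 H G²)` equal to `3 log (1 / (η δ))`. As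
  -- `H η = α`, `η √d a` is then exactly the noise bound `b * σ` with the `b` fixed above.
  obtain ⟨A, hAm, hAP, hA⟩ := LocalSGD.exists_noise_event (D := D) hℓ_meas hℓ_int hℓ_diff hG0 hG
    hgm hB hξ hlaw hind η hH1 θ₀ ⌊T / (H * η ^ 2)⌋₊
    (a := G * √(24 * H * Real.log (1 / (η * δ)))) (by positivity)
  refine ⟨A, hAm, ?_, fun w hw => ?_⟩
  · refine le_trans ?_ hAP
    have hexp : -(G * √(24 * H * Real.log (1 / (η * δ)))) ^ 2 / (2 * (H * (2 * G) ^ 2)) =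
        -(3 * Real.log (1 / (η * δ))) := by
      rw [mul_pow, Real.sq_sqrt (by positivity)]
      generalize Real.log (1 / (η * δ)) = Λ
      field_simp
      ring
    rw [hexp]
    have hsmall : 4 * T * K * d * η ≤ 1 := by
      rw [le_div_iff₀ (by positivity)] at hη2
      linarith
    linarith [LocalSGD.failure_probability_le (d := d) hη hδ0 hδ1 hα hT hH hH1 hSle hsmall]
  have key := hdet η (√(η * Real.log (1 / (η * δ)))) H ⌊T / (H * η ^ 2)⌋₊ (batch w) hη hη1 hHη hησ
    hσσ₀ (fun s hs k t ht => ?_)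
  · exact ⟨fun s hs hsS => ⟨(key s hs hsS).1, (key s hs hsS).2.1⟩,
      fun s hs hsS => (key s hs hsS.le).2.2 hsS⟩
  · refine (mul_le_mul_of_nonneg_left (hA w hw s hs k t ht) hη.le).trans_eq ?_
    have h2 : η * √(24 * H * Real.log (1 / (η * δ))) =
        √(24 * α) * √(η * Real.log (1 / (η * δ))) := by
      rw [← Real.sqrt_mul (by positivity)]
      nth_rw 1 [← Real.sqrt_sq hη.le]
      rw [← Real.sqrt_mul (by positivity), ← hHη]
      congr 1
      ring
    linear_combination (√d * G) * h2
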